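/- A virtual knot diagram is an immersion of a circle into the plane with finitely many transverse double points, each decorated as a classical crossing (with over/under information) or as a virtual crossing. A welded knot is an equivalence class of virtual knot diagrams modulo planar isotopy, the three classical Reidemeister moves, the three moves of the same shape with all crossings virtual, the mixed move (an arc with only virtual crossings passes across a classical crossing), and the welded move (an arc passing over two other arcs passes across the virtual crossing of these two arcs). Let $D$ be a virtual knot diagram. Its strands are the arcs of $D$ that run from one classical undercrossing to the next, ignoring virtual crossings (a diagram without classical crossings has one strand). $D$ is $k$-colorable if some $k$ strands (the seeds) can be colored blue so that all strands become blue by finitely many coloring moves; a coloring move at a classical crossing whose overstrand and one of whose understrands are blue colors the other understrand blue. The Wirtinger number $\omega(D)$ is the least $k$ such that $D$ is $k$-colorable, and for a welded knot $K$, $\omega(K)=\min_D \omega(D)$ over all virtual knot diagrams $D$ representing $K$. An overpass (resp. underpass) of $D$ is a path of $D$ containing at least one classical overcrossing (resp. undercrossing) and no classical undercrossing (resp. overcrossing). A bridge decomposition of $D$ is a decomposition of $D$ into a cyclically alternating sequence $O_1,U_1,\dots,O_n,U_n$, $n\ge 1$, of overpasses and underpasses. The overpass bridge number $\beta_O(K)$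 is the minimum of the number $n$ of overpasses over all bridge decompositions of all virtual knot diagrams representing $K$. **Theorem.** For every welded knot $K$, $\omega(K)=\beta_O(K)$. -/

import Mathlib

/-!
Virtual knot diagrams are handled as plane graphs whose vertices are the crossings (classical or
virtual) together with some auxiliary bivalent points. Such a graph is recorded by the list of its
vertices, each given by the labels of the edges that leave it, in counterclockwise order.
-/

/-- What a double point looks like when its four edges are read counterclockwise: either it is
classical and the first strand (slots `0` and `2`) is the overstrand, or it is classical and the
second strand (slots `1` and `3`) is the overstrand, or it is virtual. -/
inductive CrossingKind
  | firstOver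
  | secondOver
  | virt

/-- The kind of the same double point when the counterclockwise reading starts one slot later. -/
def CrossingKind.swap : CrossingKind → CrossingKind
  | firstOver => secondOver
  | secondOver => firstOver
  | virt => virt

/-- A vertex of a diagram, with its edge labels in counterclockwise order: a point in the interior
of an arc, or a double point. At a double point, opposite slots belong to the same strand. -/
inductive DiagramNode
  | point (a b : ℕ)
  | crossing (k : CrossingKind) (a b c d : ℕ)

namespace DiagramNode

def arity : DiagramNode → ℕ
  | point _ _ => 2
  | crossing _ _ _ _ _ => 4

def label : (v : DiagramNode) → Fin v.arity → ℕ
  | point a b => ![a, b]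
  | crossing _ a b c d => ![a, b, c, d]

/-- The curve passes under the other strand at this slot of a classical crossing. -/
def IsUnder : (v : DiagramNode) → Fin v.arity → Prop
  | crossing .firstOver _ _ _ _, p => p.val % 2 = 1
  | crossing .secondOver _ _ _ _, p => p.val % 2 = 0
  | _, _ => False

/-- The curve passes over the other strand at this slot of a classical crossing. -/
def IsOver : (v : DiagramNode) → Fin v.arity → Prop
  | crossing .firstOver _ _ _ _, p => p.val % 2 = 0
  | crossing .secondOver _ _ _ _, p => p.val % 2 = 1
  | _, _ => False

def relabel (f : ℕ → ℕ) : DiagramNode → DiagramNode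
  | point a b => point (f a) (f b)
  | crossing k a b c d => crossing k (f a) (f b) (f c) (f d)

end DiagramNode

/-- A dart: a vertex together with one of its slots, that is, an end of an edge. -/
abbrev Dart (l : List DiagramNode) : Type :=
  Σ i : Fin l.length, Fin (l.get i).arity

namespace Dart

variable {l : List DiagramNode}

def label (d : Dart l) : ℕ := (l.get d.1).label d.2

/-- The next dart counterclockwise around the same vertex. -/
def next (d : Dart l) : Dart l := ⟨d.1, finRotate _ d.2⟩

/-- The opposite dart at the same vertex, through which the curve continues. -/
def opp (d : Dart l) : Dart l := ⟨d.1, (finRotate _ ^ ((l.get d.1).arity / 2)) d.2⟩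

def IsUnder (d : Dart l) : Prop := (l.get d.1).IsUnder d.2

def IsOver (d : Dart l) : Prop := (l.get d.1).IsOver d.2

/-- The two darts are the two ends of one edge. -/
def SameEdge (d e : Dart l) : Prop := d ≠ e ∧ d.label = e.label

/-- One step along the curve: along an edge, or straight through a vertex. -/
def Along (d e : Dart l) : Prop := SameEdge d e ∨ e = d.opp

/-- One step along the boundary of a face. Here a dart stands for the corner between itself and the
next dart counterclockwise around its vertex. -/
def FaceStep (d e : Dart l) : Prop := SameEdge d.next e

/-- One step along the curve that does not pass through an undercrossing. -/
def StrandStep (d e : Dart l) : Prop := SameEdge d e ∨ (¬ d.IsUnder ∧ e = d.opp)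

/-- One step along the curve after every edge with a label in `C` has been cut. -/
def CutStep (C : Set ℕ) (d e : Dart l) : Prop :=
  (SameEdge d e ∧ d.label ∉ C) ∨ e = d.opp

end Dart

/-- A virtual knot diagram: an immersed circle in the plane (cut at some auxiliary points) whose
double points are classical or virtual crossings. Every edge has exactly two ends, the diagram has
one component, and the faces close up to a sphere by Euler's formula
`#vertices - #edges + #faces = 2`, where every edge consists of two darts. -/
structure VirtualKnotDiagram where
  nodes : List DiagramNode
  edge_ends : ∀ d : Dart nodes, ∃! e : Dart nodes, Dart.SameEdge d e
  one_component : Nat.card (Quot (Dart.Along (l := nodes))) = 1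
  planar : 2 * nodes.length + 2 * Nat.card (Quot (Dart.FaceStep (l := nodes))) =
    Nat.card (Dart nodes) + 4

/-- The kinds of crossings for which a strand may be moved across the crossing of two other
strands. Here `k₀₁`, `k₀₂`, `k₁₂` are the kinds of the crossings of the strands `0`, `1`, `2`,
where the strand with the smaller index counts as the first one. -/
inductive TriangleMove : CrossingKind → CrossingKind → CrossingKind → Prop
  /-- Third Reidemeister move: the strands have distinct heights, so the relation `over` between
  them is not cyclic. -/
  | classical (k₀₁ k₀₂ k₁₂ : CrossingKind)
      (h₀₁ : k₀₁ ≠ .virt) (h₀₂ : k₀₂ ≠ .virt) (h₁₂ : k₁₂ ≠ .virt)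
      (hacyclic : ¬ (k₀₁ = k₁₂ ∧ k₀₂ ≠ k₀₁)) : TriangleMove k₀₁ k₀₂ k₁₂
  /-- All three crossings are virtual. -/
  | virt : TriangleMove .virt .virt .virt
  /-- Mixed move: a strand with only virtual crossings moves across a classical crossing. -/
  | mixed₀ (k : CrossingKind) (hk : k ≠ .virt) : TriangleMove .virt .virt k
  | mixed₁ (k : CrossingKind) (hk : k ≠ .virt) : TriangleMove .virt k .virt
  | mixed₂ (k : CrossingKind) (hk : k ≠ .virt) : TriangleMove k .virt .virt
  /-- Welded move: a strand that is over the other two moves across their virtual crossing. -/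
  | welded₀ : TriangleMove .firstOver .firstOver .virt
  | welded₁ : TriangleMove .secondOver .virt .firstOver
  | welded₂ : TriangleMove .virt .secondOver .secondOver

/-- The moves that generate welded equivalence. The first six constructors do not change the plane
diagram up to planar isotopy, they change its presentation only. -/
inductive WeldedMove : List DiagramNode → List DiagramNode → Prop
  | perm {l l' : List DiagramNode} (h : l.Perm l') : WeldedMove l l'
  | relabel (f : Equiv.Perm ℕ) (l : List DiagramNode) :
      WeldedMove l (l.map (DiagramNode.relabel f))
  | rotatePoint (a b : ℕ) (l : List DiagramNode) :
      WeldedMove (.point a b :: l) (.point b a :: l)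
  | rotateCrossing (k : CrossingKind) (a b c d : ℕ) (l : List DiagramNode) :
      WeldedMove (.crossing k a b c d :: l) (.crossing k.swap b c d a :: l)
  | subdividePoint (a b c : ℕ) (l : List DiagramNode) :
      WeldedMove (.point a c :: l) (.point a b :: .point b c :: l)
  | subdivideCrossing (k : CrossingKind) (a b x y z : ℕ) (l : List DiagramNode) :
      WeldedMove (.crossing k a x y z :: l) (.point a b :: .crossing k b x y z :: l)
  /-- First Reidemeister move, classical and virtual: the edge `a` bounds a monogon. -/
  | reidemeister₁ (k : CrossingKind) (a b c : ℕ) (l : List DiagramNode) :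
      WeldedMove (.point b c :: l) (.crossing k a a b c :: l)
  /-- Second Reidemeister move, classical and virtual: the edges `e` and `f` bound a bigon, and one
  and the same strand is over at both of its vertices, or both of them are virtual. -/
  | reidemeister₂ (k : CrossingKind) (e e₁ e₂ f f₁ f₂ : ℕ) (l : List DiagramNode) :
      WeldedMove (.point e₁ e₂ :: .point f₁ f₂ :: l)
        (.crossing k f e f₁ e₁ :: .crossing k.swap e f e₂ f₂ :: l)
  /-- Third Reidemeister move, its virtual and mixed versions, and the welded move. Strand `i`
  runs from `xᵢ` to `yᵢ`; the six ends lie on the boundary of a disk in the counterclockwise order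
  `x₀, x₁, x₂, y₀, y₁, y₂`; and `p₀`, `p₁`, `p₂` bound a triangle on both sides of the move. -/
  | triangle (k₀₁ k₀₂ k₁₂ : CrossingKind) (hk : TriangleMove k₀₁ k₀₂ k₁₂)
      (x₀ x₁ x₂ y₀ y₁ y₂ p₀ p₁ p₂ : ℕ) (l : List DiagramNode) :
      WeldedMove
        (.crossing k₀₁ p₀ p₁ y₀ y₁ :: .crossing k₀₂ x₀ p₂ p₀ y₂ ::
          .crossing k₁₂ x₁ x₂ p₁ p₂ :: l)
        (.crossing k₀₁ x₀ x₁ p₀ p₁ :: .crossing k₀₂ p₀ x₂ y₀ p₂ ::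
          .crossing k₁₂ p₁ p₂ y₁ y₂ :: l)

/-- A welded knot: a class of virtual knot diagrams under the equivalence relation generated by the
moves. -/
def WeldedKnot : Type :=
  Quot fun D D' : VirtualKnotDiagram => WeldedMove D.nodes D'.nodes

namespace VirtualKnotDiagram

/-- The welded knot that the diagram represents. -/
def toWeldedKnot (D : VirtualKnotDiagram) : WeldedKnot := Quot.mk _ D

/-- The strands of the diagram: its arcs from undercrossing to undercrossing, virtual crossings
being ignored (the whole circle if there is no classical crossing). -/
def Strand (D : VirtualKnotDiagram) : Type := Quot (Dart.StrandStep (l := D.nodes))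

/-- The strand that contains the given end of an edge. -/
def strand (D : VirtualKnotDiagram) (d : Dart D.nodes) : D.Strand := Quot.mk _ d

/-- The strands that become blue through coloring moves when the seeds are blue. A coloring move at
a classical crossing: if its overstrand and one of its understrands are blue, then the other
understrand becomes blue. -/
inductive Blue (D : VirtualKnotDiagram) (seeds : Set D.Strand) : D.Strand → Prop
  | seed {s : D.Strand} (h : s ∈ seeds) : Blue D seeds s
  | move {o u : Dart D.nodes} (hnode : o.1 = u.1) (ho : o.IsOver) (hu : u.IsUnder)
      (hob : Blue D seeds (D.strand o)) (hub : Blue D seeds (D.strand u)) :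
      Blue D seeds (D.strand u.opp)

/-- Some `k` seeds color the whole diagram. -/
def IsColorable (D : VirtualKnotDiagram) (k : ℕ) : Prop :=
  ∃ seeds : Set D.Strand, seeds.Finite ∧ seeds.ncard = k ∧ ∀ s, D.Blue seeds s

/-- The Wirtinger number of a diagram. -/
noncomputable def wirtingerNumber (D : VirtualKnotDiagram) : ℕ := sInf {k | D.IsColorable k}

/-- The paths into which the curve falls when one cuts the edges with a label in `C`. -/
def Path (D : VirtualKnotDiagram) (C : Set ℕ) : Type := Quot (Dart.CutStep (l := D.nodes) C)

/-- The path that contains the given end of an edge. -/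
def path (D : VirtualKnotDiagram) (C : Set ℕ) (d : Dart D.nodes) : D.Path C := Quot.mk _ d

/-- At least one overcrossing and no undercrossing. -/
def IsOverpass (D : VirtualKnotDiagram) {C : Set ℕ} (P : D.Path C) : Prop :=
  (∃ d, D.path C d = P ∧ d.IsOver) ∧ ∀ d, D.path C d = P → ¬ d.IsUnder

/-- At least one undercrossing and no overcrossing. -/
def IsUnderpass (D : VirtualKnotDiagram) {C : Set ℕ} (P : D.Path C) : Prop :=
  (∃ d, D.path C d = P ∧ d.IsUnder) ∧ ∀ d, D.path C d = P → ¬ d.IsOver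

/-- Cutting the edges with a label in `C` is a bridge decomposition: every path is an overpass or an
underpass, and they alternate, i.e. an overpass and an underpass meet at each cut. -/
def IsBridgeDecomposition (D : VirtualKnotDiagram) (C : Set ℕ) : Prop :=
  (∀ P : D.Path C, D.IsOverpass P ∨ D.IsUnderpass P) ∧
    ∀ d e : Dart D.nodes, Dart.SameEdge d e → d.label ∈ C →
      (D.IsOverpass (D.path C d) ↔ D.IsUnderpass (D.path C e))

/-- The number of overpasses among the paths. -/
noncomputable def overpassCount (D : VirtualKnotDiagram) (C : Set ℕ) : ℕ :=
  Nat.card {P : D.Path C // D.IsOverpass P}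

end VirtualKnotDiagram

namespace WeldedKnot

/-- The Wirtinger number `ω(K)`: the minimum of the Wirtinger numbers of the diagrams of `K`. -/
noncomputable def wirtingerNumber (K : WeldedKnot) : ℕ :=
  sInf {k | ∃ D : VirtualKnotDiagram, D.toWeldedKnot = K ∧ D.wirtingerNumber = k}

/-- The overpass bridge number `β_O(K)`: the minimum number of overpasses over all bridge
decompositions of diagrams of `K`. A diagram without classical crossings has no such
decomposition. -/
noncomputable def overpassBridgeNumber (K : WeldedKnot) : ℕ :=
  sInf {n | ∃ (D : VirtualKnotDiagram) (C : Set ℕ), D.toWeldedKnot = K ∧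
    D.IsBridgeDecomposition C ∧ D.overpassCount C = n}

end WeldedKnot

/-! For `ω ≤ β_O`, the seeds are the strands of the overpasses of a bridge decomposition. An
overpass has no undercrossing, so it stays on one strand, and every overcrossing lies on some
overpass. Hence all overstrands are blue from the start, and blue spreads through every
undercrossing around the single component (`IsBridgeDecomposition.exists_isColorable`).

For `β_O ≤ ω` the diagram must be changed. The level of a strand is the round in which it becomes
blue; a strand of positive level then has an end at a crossing whose other two strands have lower
level (`IsColorable.exists_ranked`). Let `H > 0` be an upper bound for the levels of strands with
overcrossings, and let `p` be the edge at that end of such a strand of level `H`. At the far end of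
`p` there is an auxiliary point, which is absorbed, or another strand `w` that passes under `p` or
crosses it virtually. In the latter case `w` is pushed back over the end of the strand by a second
Reidemeister move followed by a third Reidemeister or a mixed move (`Presents.push`). Afterwards `w`
meets the overstrand twice and the other understrand once in place of `p`: the Wirtinger relation,
seen geometrically. If `w` passed under, it is cut into additional short strands, but these have no
overcrossings and their level is irrelevant. A weight decreases (`Ranked.weight_push`), so the
overcrossings of level `H` disappear, then `H` can be lowered, until all overcrossings lie on
strands of level `0`, of which there are at most `k` (`exists_level_zero`).

In such a diagram, cutting the strands with overcrossings next to their ends gives one overpass for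
each of them (`exists_isBridgeDecomposition`). If no classical crossing is left, a kink supplies one
overpass, and `k > 0`. The welded move is never applied.

The remaining work is to show that each modified list is again a plane closed curve. Each local move
exchanges two tangles in a disk that look alike from outside; finite certificates establish this for
the tangles involved (`isPlaneCurve_exchange`). -/

/-! ### Counting classes of quotients -/

/-- If maps between two types induce mutually inverse maps of the quotients, then these are
equinumerous. -/
theorem card_quot_eq {W Z : Type*} {r : W → W → Prop} {s : Z → Z → Prop} (c : W → Z) (g : Z → W)
    (hc : ∀ w w', r w w' → Quot.mk s (c w) = Quot.mk s (c w'))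
    (hg : ∀ z z', s z z' → Quot.mk r (g z) = Quot.mk r (g z'))
    (hgc : ∀ w, Quot.mk r (g (c w)) = Quot.mk r w)
    (hcg : ∀ z, Quot.mk s (c (g z)) = Quot.mk s z) :
    Nat.card (Quot r) = Nat.card (Quot s) := by
  refine Nat.card_congr
    { toFun := Quot.lift (fun w => Quot.mk s (c w)) hc
      invFun := Quot.lift (fun z => Quot.mk r (g z)) hg
      left_inv := ?_
      right_inv := ?_ }
  · rintro ⟨w⟩; exact hgc w
  · rintro ⟨z⟩; exact hcg z

/-- Extra isolated points raise the number of classes by their number. -/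
theorem card_quot_add {W Z I : Type*} [Finite Z] [Finite I] {r : W → W → Prop} {s : Z → Z → Prop}
    (c : W → Z ⊕ I) (g : Z ⊕ I → W)
    (hc : ∀ w w', r w w' → c w = c w' ∨ ∃ z z', c w = .inl z ∧ c w' = .inl z' ∧ s z z')
    (hg : ∀ z z', s z z' → Quot.mk r (g (.inl z)) = Quot.mk r (g (.inl z')))
    (hgc : ∀ w, Quot.mk r (g (c w)) = Quot.mk r w)
    (hcg : ∀ z, c (g z) = z) :
    Nat.card (Quot r) = Nat.card (Quot s) + Nat.card I := by
  have : Finite (Quot s) := Finite.of_surjective _ Quot.mk_surjective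
  rw [← Nat.card_sum]
  let F : Z ⊕ I → Quot s ⊕ I := Sum.map (Quot.mk s) id
  refine Nat.card_congr
    { toFun := Quot.lift (fun w => F (c w)) ?_
      invFun := Sum.elim (Quot.lift (fun z => Quot.mk r (g (.inl z))) hg)
        (fun i => Quot.mk r (g (.inr i)))
      left_inv := ?_
      right_inv := ?_ }
  · intro w w' h
    rcases hc w w' h with h | ⟨z, z', h1, h2, h3⟩
    · simp only [h]
    · simp only [h1, h2, F, Sum.map_inl]
      rw [Quot.sound h3]
  · rintro ⟨w⟩
    have h := hgc w
    change Sum.elim _ _ (F (c w)) = _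
    rcases hw : c w with z | i <;> rw [hw] at h <;> exact h
  · rintro (z | i)
    · obtain ⟨z, rfl⟩ := Quot.mk_surjective z
      exact congrArg F (hcg (.inl z))
    · exact congrArg F (hcg (.inr i))

/-! ### Plane closed curves and the exchange of tangles -/

/-- The darts of a diagram with their labels, and the next and the opposite dart of each. -/
structure DartSystem (X : Type) where
  label : X → ℕ
  next : X → X
  opp : X → X

namespace DartSystem

variable {X Y : Type}

def SameEdge (S : DartSystem X) (x y : X) : Prop := x ≠ y ∧ S.label x = S.label y

def Along (S : DartSystem X) (x y : X) : Prop := S.SameEdge x y ∨ y = S.opp x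

def FaceStep (S : DartSystem X) (x y : X) : Prop := S.SameEdge (S.next x) y

instance (S : DartSystem X) [DecidableEq X] (x y : X) : Decidable (S.SameEdge x y) :=
  inferInstanceAs (Decidable (_ ∧ _))

/-- The system presents a plane closed curve, if it has `v` vertices. -/
structure IsPlaneCurve (S : DartSystem X) (v : ℕ) : Prop where
  edge_ends : ∀ x, ∃! y, S.SameEdge x y
  one_component : Nat.card (Quot S.Along) = 1
  planar : 2 * v + 2 * Nat.card (Quot S.FaceStep) = Nat.card X + 4

/-- Disjoint union, where the labels of the first system are translated by `f`. -/
def glue (S : DartSystem X) (f : ℕ → ℕ) (T : DartSystem Y) : DartSystem (X ⊕ Y) where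
  label := Sum.elim (fun x => f (S.label x)) T.label
  next := Sum.map S.next T.next
  opp := Sum.map S.opp T.opp

theorem IsPlaneCurve.congr {S : DartSystem X} {T : DartSystem Y} {v : ℕ} (e : X ≃ Y)
    (hl : ∀ x, T.label (e x) = S.label x) (hn : ∀ x, T.next (e x) = e (S.next x))
    (ho : ∀ x, T.opp (e x) = e (S.opp x)) (h : S.IsPlaneCurve v) : T.IsPlaneCurve v := by
  have hs : ∀ x y, S.SameEdge x y ↔ T.SameEdge (e x) (e y) := by
    intro x y; simp [SameEdge, hl]
  refine ⟨?_, ?_, ?_⟩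
  · intro y
    obtain ⟨x, rfl⟩ := e.surjective y
    obtain ⟨z, hz, hu⟩ := h.edge_ends x
    refine ⟨e z, (hs _ _).1 hz, ?_⟩
    intro w hw
    obtain ⟨w, rfl⟩ := e.surjective w
    rw [hu w ((hs _ _).2 hw)]
  · rw [← h.one_component]
    refine Nat.card_congr (Quot.congr e ?_).symm
    intro a b
    simp [Along, hs, ho]
  · rw [← Nat.card_congr e, ← h.planar]
    congr 2
    refine Nat.card_congr (Quot.congr e ?_).symm
    intro a b
    simp [FaceStep, hs, hn]

/-- A single fat vertex with slots `Fin n` that carry the labels `0, …, n - 1`. -/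
def fat {n : ℕ} (nxt op : Fin n → Fin n) : DartSystem (Fin n) where
  label := Fin.val
  next := nxt
  opp := op

/-- A certificate that the system `S` is a tangle in a disk, with `n` ends, which carry the labels
`0, …, n - 1`: from outside it looks like a fat vertex with `m` additional faces inside. -/
structure Tangle (S : DartSystem X) {n : ℕ} (m : ℕ) (nxt op : Fin n → Fin n) where
  /-- the ends -/
  bd : Fin n → X
  /-- the face in which a corner lies -/
  face : X → Fin n ⊕ Fin m
  /-- a corner for each of the inner faces -/
  rep : Fin m → X
  /-- the arc on which a dart lies -/
  arc : X → Fin n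
  faceRank : X → ℕ
  arcRank : X → ℕ
  bd_label : ∀ i, S.label (bd i) = i
  bd_unique : ∀ x (i : Fin n), S.label x = i → x = bd i
  inner_edge : ∀ x, n ≤ S.label x → ∃ y, S.SameEdge x y ∧ ∀ z, S.SameEdge x z → z = y
  face_bd : ∀ i, face (bd i) = .inl i
  face_rep : ∀ j, face (rep j) = .inr j
  face_step : ∀ x y, n ≤ S.label (S.next x) → S.SameEdge (S.next x) y → face x = face y
  face_exit : ∀ x i, S.next x = bd i → ∃ j, face x = .inl j ∧ nxt j = i
  exit : ∀ i, ∃ x, S.next x = bd (nxt i) ∧ face x = .inl i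
  face_rank : ∀ x, x = Sum.elim bd rep (face x) ∨
    ∃ y, n ≤ S.label (S.next y) ∧ S.SameEdge (S.next y) x ∧ faceRank y < faceRank x
  arc_edge : ∀ x y, n ≤ S.label x → S.SameEdge x y → arc x = arc y
  arc_opp : ∀ x, arc (S.opp x) = arc x
  arc_bd : ∀ i, arc (bd i) = i ∨ arc (bd i) = op i
  arc_op : ∀ i, arc (bd (op i)) = arc (bd i)
  arc_rank : ∀ x, x = bd (arc x) ∨ ∃ y, ((n ≤ S.label y ∧ S.SameEdge y x) ∨ x = S.opp y) ∧
    arcRank y < arcRank x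

namespace Tangle

variable {S : DartSystem X} {n m : ℕ} {nxt op : Fin n → Fin n} (t : S.Tangle m nxt op)
  {f : ℕ → ℕ} {T : DartSystem Y}

/-- An end of the tangle or a dart outside. -/
def emb (z : Fin n ⊕ Y) : X ⊕ Y := Sum.map t.bd id z

theorem bd_injective : Function.Injective t.bd := by
  intro i j h
  have := congrArg S.label h
  rw [t.bd_label, t.bd_label] at this
  exact Fin.ext this

theorem emb_injective : Function.Injective (t.emb (Y := Y)) :=
  Sum.map_injective.2 ⟨t.bd_injective, Function.injective_id⟩

theorem label_emb (z : Fin n ⊕ Y) :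
    (S.glue f T).label (t.emb z) = ((fat nxt op).glue f T).label z := by
  rcases z with i | y
  · simp [emb, glue, fat, t.bd_label]
  · rfl

theorem sameEdge_emb (z z' : Fin n ⊕ Y) : (S.glue f T).SameEdge (t.emb z) (t.emb z') ↔
    ((fat nxt op).glue f T).SameEdge z z' := by
  simp only [SameEdge, t.label_emb, ne_eq, t.emb_injective.eq_iff]

/-- The labels of inner edges are translated by `f` to new labels. -/
def Fresh (S : DartSystem X) (n : ℕ) (f : ℕ → ℕ) (T : DartSystem Y) : Prop :=
  ∀ x, n ≤ S.label x → (∀ j, j < n ∨ j ∈ Set.range S.label → f (S.label x) = f j → S.label x = j) ∧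
    ∀ y, T.label y ≠ f (S.label x)

theorem exists_emb_or (w : X ⊕ Y) : (∃ z, w = t.emb z) ∨ ∃ x, w = .inl x ∧ n ≤ S.label x := by
  rcases w with x | y
  · by_cases h : n ≤ S.label x
    · exact .inr ⟨x, rfl, h⟩
    · refine .inl ⟨.inl ⟨S.label x, not_le.1 h⟩, ?_⟩
      exact congrArg Sum.inl (t.bd_unique x ⟨S.label x, not_le.1 h⟩ rfl)
  · exact .inl ⟨.inr y, rfl⟩

theorem sameEdge_inner (hf : Fresh S n f T) {x : X} (hx : n ≤ S.label x) (w : X ⊕ Y) :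
    (S.glue f T).SameEdge (.inl x) w ↔ ∃ x', w = .inl x' ∧ S.SameEdge x x' := by
  rcases w with x' | y
  · simp only [SameEdge, glue, Sum.elim_inl, ne_eq, Sum.inl.injEq, exists_eq_left']
    refine and_congr_right fun _ => ⟨fun h => (hf x hx).1 _ (.inr ⟨x', rfl⟩) h, fun h => by rw [h]⟩
  · simp only [SameEdge, glue, Sum.elim_inl, Sum.elim_inr, reduceCtorEq, false_and, exists_false,
      iff_false]
    rintro ⟨-, h⟩
    exact (hf x hx).2 y h.symm

/-- Inner labels are new, so an edge that starts at an end of the tangle or outside cannot finish at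
an inner dart. The visible part of the glued system is therefore closed under `SameEdge`. -/
theorem sameEdge_outer (hf : Fresh S n f T) {z : Fin n ⊕ Y} {w : X ⊕ Y}
    (h : (S.glue f T).SameEdge (t.emb z) w) :
    ∃ z', w = t.emb z' ∧ ((fat nxt op).glue f T).SameEdge z z' := by
  rcases t.exists_emb_or w with ⟨z', rfl⟩ | ⟨x, rfl, hx⟩
  · exact ⟨z', rfl, (t.sameEdge_emb z z').1 h⟩
  · have h2 : (S.glue f T).SameEdge (.inl x) (t.emb z) := ⟨h.1.symm, h.2.symm⟩
    rw [sameEdge_inner hf hx] at h2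
    obtain ⟨x', hz, hxx'⟩ := h2
    rcases z with i | y
    · have hx' : t.bd i = x' := Sum.inl.inj hz
      have := hxx'.2
      rw [← hx', t.bd_label] at this
      omega
    · cases hz

theorem edge_ends_iff (t : S.Tangle m nxt op) (hf : Fresh S n f T) : (∀ w, ∃! w', (S.glue f T).SameEdge w w') ↔
    ∀ z, ∃! z', ((fat nxt op).glue f T).SameEdge z z' := by
  constructor
  · intro h z
    obtain ⟨w, hw, hu⟩ := h (t.emb z)
    obtain ⟨z', rfl, hz'⟩ := t.sameEdge_outer hf hw
    refine ⟨z', hz', fun z'' h'' => ?_⟩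
    exact t.emb_injective (hu _ ((t.sameEdge_emb z z'').2 h''))
  · intro h w
    rcases t.exists_emb_or w with ⟨z, rfl⟩ | ⟨x, rfl, hx⟩
    · obtain ⟨z', hz', hu⟩ := h z
      refine ⟨t.emb z', (t.sameEdge_emb z z').2 hz', fun w' hw' => ?_⟩
      obtain ⟨z'', rfl, hz''⟩ := t.sameEdge_outer hf hw'
      rw [hu z'' hz'']
    · obtain ⟨y, hy, hu⟩ := t.inner_edge x hx
      refine ⟨.inl y, (sameEdge_inner hf hx _).2 ⟨y, rfl, hy⟩, fun w hw => ?_⟩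
      obtain ⟨x', rfl, hx'⟩ := (sameEdge_inner hf hx _).1 hw
      rw [hu x' hx']

/-- `face_rank` leads from any corner, along inner edges and with falling rank, to the chosen corner
of its face; each such step is a face step of the glued system. -/
theorem mk_face (hf : Fresh S n f T) (x : X) :
    Quot.mk (S.glue f T).FaceStep (.inl (Sum.elim t.bd t.rep (t.face x))) =
      Quot.mk (S.glue f T).FaceStep (.inl x) := by
  induction h : t.faceRank x using Nat.strong_induction_on generalizing x with
  | _ r ih =>
    rcases t.face_rank x with hx | ⟨y, hy, hyx, hlt⟩
    · rw [← hx]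
    · rw [← t.face_step y x hy hyx, ih _ (h ▸ hlt) y rfl]
      exact Quot.sound ((sameEdge_inner hf hy _).2 ⟨x, rfl, hyx⟩)

/-- Collapse each inner corner to its face. A face step along an inner edge becomes trivial, and one
that leaves the tangle becomes a face step of the fat vertex; the `m` inner faces remain as isolated
classes. -/
theorem card_faces [Finite Y] (t : S.Tangle m nxt op) (hf : Fresh S n f T) : Nat.card (Quot (S.glue f T).FaceStep) =
    Nat.card (Quot ((fat nxt op).glue f T).FaceStep) + m := by
  have key := card_quot_add (r := (S.glue f T).FaceStep) (s := ((fat nxt op).glue f T).FaceStep)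
    (I := Fin m)
    (Sum.elim (fun x => Sum.map .inl id (t.face x)) fun y => .inl (.inr y))
    (Sum.elim t.emb fun j => .inl (t.rep j)) ?_ ?_ ?_ ?_
  · simpa using key
  · rintro (x | y) w h
    · by_cases hx : n ≤ S.label (S.next x)
      · left
        obtain ⟨x', rfl, hx'⟩ := (sameEdge_inner hf hx _).1 h
        simp only [Sum.elim_inl, t.face_step x x' hx hx']
      · right
        have hi := t.bd_unique _ ⟨_, not_le.1 hx⟩ rfl
        generalize (⟨_, not_le.1 hx⟩ : Fin n) = i at hi
        obtain ⟨j, hj, rfl⟩ := t.face_exit x i hi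
        have h' : (S.glue f T).SameEdge (t.emb (.inl (nxt j))) w := by
          have : t.emb (Y := Y) (.inl (nxt j)) = .inl (S.next x) := by simp [emb, hi]
          rw [this]; exact h
        obtain ⟨z', rfl, hz'⟩ := t.sameEdge_outer hf h'
        refine ⟨.inl j, z', by simp [hj], ?_, hz'⟩
        rcases z' with i' | y' <;> simp [emb, t.face_bd]
    · right
      obtain ⟨z', rfl, hz'⟩ := t.sameEdge_outer (z := .inr (T.next y)) hf h
      refine ⟨.inr y, z', rfl, ?_, hz'⟩
      rcases z' with i' | y' <;> simp [emb, t.face_bd]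
  · rintro (i | y) z' h
    · obtain ⟨x, hx, hxi⟩ := t.exit i
      have h1 := t.mk_face hf x
      rw [hxi] at h1
      refine h1.trans (Quot.sound ?_)
      have h2 := (t.sameEdge_emb (f := f) (T := T) (.inl (nxt i)) z').2 h
      have : t.emb (Y := Y) (.inl (nxt i)) = .inl (S.next x) := by simp [emb, hx]
      rw [this] at h2
      exact h2
    · exact Quot.sound ((t.sameEdge_emb (f := f) (T := T) (.inr (T.next y)) z').2 h)
  · rintro (x | y)
    · have h := t.mk_face hf x
      rcases hx : t.face x with i | j <;> rw [hx] at h <;> simpa [hx, emb] using h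
    · rfl
  · rintro ((i | y) | j) <;> simp [emb, t.face_bd, t.face_rep]

theorem mk_arc (hf : Fresh S n f T) (x : X) :
    Quot.mk (S.glue f T).Along (.inl (t.bd (t.arc x))) =
      Quot.mk (S.glue f T).Along (.inl x) := by
  induction h : t.arcRank x using Nat.strong_induction_on generalizing x with
  | _ r ih =>
    rcases t.arc_rank x with hx | ⟨y, ⟨hy, hyx⟩ | hyx, hlt⟩
    · rw [← hx]
    · rw [← t.arc_edge y x hy hyx, ih _ (h ▸ hlt) y rfl]
      exact Quot.sound (.inl ((sameEdge_inner hf hy _).2 ⟨x, rfl, hyx⟩))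
    · rw [hyx, t.arc_opp, ih _ (h ▸ hlt) y rfl]
      exact Quot.sound (.inr rfl)

theorem mk_arc_bd (i : Fin n) : Quot.mk ((fat nxt op).glue f T).Along (.inl (t.arc (t.bd i))) =
    Quot.mk ((fat nxt op).glue f T).Along (.inl i) := by
  rcases t.arc_bd i with h | h <;> rw [h]
  exact (Quot.sound (.inr rfl)).symm

/-- Each arc of the tangle contracts to one of its ends, and `op` joins the same pairs of ends as
the arcs do. -/
theorem card_components (t : S.Tangle m nxt op) (hf : Fresh S n f T) : Nat.card (Quot (S.glue f T).Along) =
    Nat.card (Quot ((fat nxt op).glue f T).Along) := by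
  have hemb : ∀ z : Fin n ⊕ Y, Quot.mk ((fat nxt op).glue f T).Along
      (Sum.elim (fun x => .inl (t.arc x)) .inr (t.emb z)) = Quot.mk _ z := by
    rintro (i | y)
    · exact t.mk_arc_bd i
    · rfl
  refine card_quot_eq (Sum.elim (fun x => .inl (t.arc x)) .inr) t.emb ?_ ?_ ?_ ?_
  · rintro w w' (h | rfl)
    · rcases t.exists_emb_or w with ⟨z, rfl⟩ | ⟨x, rfl, hx⟩
      · obtain ⟨z', rfl, hz'⟩ := t.sameEdge_outer hf h
        rw [hemb, hemb]
        exact Quot.sound (.inl hz')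
      · obtain ⟨x', rfl, hx'⟩ := (sameEdge_inner hf hx _).1 h
        simp only [Sum.elim_inl, t.arc_edge x x' hx hx']
    · rcases w with x | y
      · simp [glue, t.arc_opp]
      · exact Quot.sound (.inr rfl)
  · rintro z z' (h | rfl)
    · exact Quot.sound (.inl ((t.sameEdge_emb z z').2 h))
    · rcases z with i | y
      · change Quot.mk _ (Sum.inl (t.bd i)) = Quot.mk _ (Sum.inl (t.bd (op i)))
        rw [← t.mk_arc hf (t.bd i), ← t.mk_arc hf (t.bd (op i)), t.arc_op]
      · exact Quot.sound (.inr rfl)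
  · rintro (x | y)
    · exact t.mk_arc hf x
    · rfl
  · exact hemb

/-- A tangle may be exchanged for another one that looks the same from outside. -/
theorem isPlaneCurve_exchange (t : S.Tangle m nxt op) {X' : Type} {S' : DartSystem X'} {m' : ℕ} [Finite X] [Finite X']
    [Finite Y] (t' : S'.Tangle m' nxt op) {v v' u : ℕ} (hv : 2 * v + 2 * m + n = Nat.card X + 2)
    (hv' : 2 * v' + 2 * m' + n = Nat.card X' + 2) (hf : Fresh S n f T) (hf' : Fresh S' n f T)
    (h : (S.glue f T).IsPlaneCurve (v + u)) : (S'.glue f T).IsPlaneCurve (v' + u) := by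
  refine ⟨?_, ?_, ?_⟩
  · rw [t'.edge_ends_iff hf', ← t.edge_ends_iff hf]; exact h.edge_ends
  · rw [t'.card_components hf', ← t.card_components hf]; exact h.one_component
  -- By `hv` and `hv'` each tangle contributes to Euler's formula what one vertex with `n` darts
  -- contributes, so the two conditions are equivalent.
  · have := h.planar
    rw [t.card_faces hf, Nat.card_sum] at this
    rw [t'.card_faces hf', Nat.card_sum]
    omega

end Tangle

end DartSystem

/-! ### Lists of vertices as dart systems -/

namespace DiagramNode

def labels : DiagramNode → List ℕ
  | point a b => [a, b]
  | crossing _ a b c d => [a, b, c, d]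

theorem mem_labels {v : DiagramNode} {x : ℕ} : x ∈ v.labels ↔ ∃ p, v.label p = x := by
  cases v with
  | point a b =>
    change x ∈ [a, b] ↔ ∃ p : Fin 2, (![a, b] : Fin 2 → ℕ) p = x
    simp [Fin.exists_fin_two, eq_comm]
  | crossing k a b c d =>
    change x ∈ [a, b, c, d] ↔ ∃ p : Fin 4, (![a, b, c, d] : Fin 4 → ℕ) p = x
    simp [Fin.exists_fin_succ, eq_comm]

/-- The second node is the first one, up to the kind of crossing, with labels translated by `f`. -/
inductive Shape (f : ℕ → ℕ) : DiagramNode → DiagramNode → Prop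
  | point (a b : ℕ) : Shape f (point a b) (point (f a) (f b))
  | crossing (k k' : CrossingKind) (a b c d : ℕ) :
      Shape f (crossing k a b c d) (crossing k' (f a) (f b) (f c) (f d))

end DiagramNode

/-- The labels of all edge ends. -/
def edgeLabels (l : List DiagramNode) : List ℕ := l.flatMap DiagramNode.labels

namespace Dart

/-- The darts of a list, as a system. -/
def system (l : List DiagramNode) : DartSystem (Dart l) where
  label := label
  next := next
  opp := opp

theorem mem_edgeLabels {l : List DiagramNode} {x : ℕ} :
    x ∈ edgeLabels l ↔ ∃ d : Dart l, d.label = x := by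
  simp only [edgeLabels, List.mem_flatMap, DiagramNode.mem_labels]
  constructor
  · rintro ⟨v, hv, p, hp⟩
    obtain ⟨i, rfl⟩ := List.mem_iff_get.1 hv
    exact ⟨⟨i, p⟩, hp⟩
  · rintro ⟨⟨i, p⟩, hp⟩
    exact ⟨l.get i, List.get_mem _ _, p, hp⟩

/-- A dart of the first node of a list. -/
def head (v : DiagramNode) (l : List DiagramNode) (p : Fin v.arity) : Dart (v :: l) :=
  ⟨⟨0, Nat.zero_lt_succ _⟩, p⟩

/-- A dart of the remaining nodes of a list. -/
def tail (v : DiagramNode) {l : List DiagramNode} (d : Dart l) : Dart (v :: l) := ⟨d.1.succ, d.2⟩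

theorem bijective_cons (v : DiagramNode) (l : List DiagramNode) :
    Function.Bijective (Sum.elim (head v l) (tail v (l := l))) := by
  constructor
  · rintro (p | ⟨i, p⟩) (q | ⟨j, q⟩) h
    · simp only [Sum.elim_inl, head, Sigma.mk.injEq, heq_eq_eq, true_and] at h
      rw [h]
    · simp only [Sum.elim_inl, Sum.elim_inr, head, tail, Sigma.mk.injEq] at h
      simp [Fin.ext_iff] at h
    · simp only [Sum.elim_inl, Sum.elim_inr, head, tail, Sigma.mk.injEq] at h
      simp [Fin.ext_iff] at h
    · simp only [Sum.elim_inr, tail, Sigma.mk.injEq, Fin.succ_inj] at h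
      obtain ⟨rfl, h⟩ := h
      rw [heq_iff_eq] at h
      rw [h]
  · rintro ⟨⟨_ | i, hi⟩, p⟩
    · exact ⟨.inl p, rfl⟩
    · exact ⟨.inr ⟨⟨i, Nat.lt_of_succ_lt_succ hi⟩, p⟩, rfl⟩

/-- The darts of a list are those of its first node and those of the rest. -/
noncomputable def consEquiv (v : DiagramNode) (l : List DiagramNode) :
    Fin v.arity ⊕ Dart l ≃ Dart (v :: l) := Equiv.ofBijective _ (bijective_cons v l)

/-- A bijection that respects the structure of two systems. -/
def Preserves {X Y : Type} (S : DartSystem X) (T : DartSystem Y) (e : X ≃ Y) : Prop :=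
  (∀ x, T.label (e x) = S.label x) ∧ (∀ x, T.next (e x) = e (S.next x)) ∧
    ∀ x, T.opp (e x) = e (S.opp x)

theorem exists_equiv_head {f : ℕ → ℕ} {v v' : DiagramNode} (h : v.Shape f v')
    (l : List DiagramNode) : ∃ e : Fin v.arity ≃ Fin v'.arity,
      (∀ p, (head v' l (e p)).label = f (v.label p)) ∧
      (∀ p, (head v' l (e p)).next = head v' l (e (finRotate _ p))) ∧
      ∀ p, (head v' l (e p)).opp = head v' l (e ((finRotate _ ^ (v.arity / 2)) p)) := by
  cases h with
  | point a b =>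
    refine ⟨Equiv.refl _, fun p => ?_, fun p => rfl, fun p => rfl⟩
    change (![f a, f b] : Fin 2 → ℕ) p = f ((![a, b] : Fin 2 → ℕ) p)
    revert p; exact Fin.forall_fin_two.2 ⟨rfl, rfl⟩
  | crossing k k' a b c d =>
    refine ⟨Equiv.refl _, fun p => ?_, fun p => rfl, fun p => rfl⟩
    change (![f a, f b, f c, f d] : Fin 4 → ℕ) p = f ((![a, b, c, d] : Fin 4 → ℕ) p)
    revert p; change ∀ p : Fin 4, _
    simp [Fin.forall_fin_succ]

/-- Since `Shape` forgets the kinds of crossings, a certificate for a tangle with virtual crossings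
serves for all kinds. -/
theorem exists_equiv_append {f : ℕ → ℕ} {A A' : List DiagramNode}
    (h : List.Forall₂ (DiagramNode.Shape f) A A') (l : List DiagramNode) :
    ∃ e : Dart A ⊕ Dart l ≃ Dart (A' ++ l),
      Preserves ((system A).glue f (system l)) (system (A' ++ l)) e := by
  induction h with
  | nil =>
    have : IsEmpty (Dart []) := ⟨fun d => d.1.elim0⟩
    refine ⟨Equiv.emptySum _ _, ?_, ?_, ?_⟩ <;> rintro (x | x)
    all_goals first | exact isEmptyElim x | rfl
  | @cons v v' A A' hv hA ih =>
    obtain ⟨e, h1, h2, h3⟩ := ih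
    obtain ⟨e', g1, g2, g3⟩ := exists_equiv_head hv (A' ++ l)
    let E := ((consEquiv v A).symm.sumCongr (Equiv.refl (Dart l))).trans
      ((Equiv.sumAssoc _ _ _).trans ((e'.sumCongr e).trans (consEquiv v' (A' ++ l))))
    have E1 : ∀ p, E (.inl (consEquiv v A (.inl p))) = head v' (A' ++ l) (e' p) := fun p => by
      simp only [E, Equiv.trans_apply, Equiv.sumCongr_apply, Sum.map_inl, Equiv.symm_apply_apply]; rfl
    have E2 : ∀ x, E (.inl (consEquiv v A (.inr x))) = tail v' (e (.inl x)) := fun x => by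
      simp only [E, Equiv.trans_apply, Equiv.sumCongr_apply, Sum.map_inl, Equiv.symm_apply_apply]; rfl
    have E3 : ∀ x, E (.inr x) = tail v' (e (.inr x)) := fun x => by
      simp only [E, Equiv.trans_apply, Equiv.sumCongr_apply, Sum.map_inr]; rfl
    refine ⟨E, ?_, ?_, ?_⟩ <;> rintro (x | x)
    all_goals try obtain ⟨p | x, rfl⟩ := (consEquiv v A).surjective x
    all_goals first | rw [E1] | rw [E2] | rw [E3]
    · exact g1 p
    · exact h1 (.inl x)
    · exact h1 (.inr x)
    · exact (g2 p).trans (E1 _).symm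
    · exact (congrArg (tail v') (h2 (.inl x))).trans (E2 x.next).symm
    · exact (congrArg (tail v') (h2 (.inr x))).trans (E3 x.next).symm
    · exact (g3 p).trans (E1 _).symm
    · exact (congrArg (tail v') (h3 (.inl x))).trans (E2 x.opp).symm
    · exact (congrArg (tail v') (h3 (.inr x))).trans (E3 x.opp).symm

theorem exists_equiv_perm {l l' : List DiagramNode} (h : l.Perm l') :
    ∃ e : Dart l ≃ Dart l', Preserves (system l) (system l') e := by
  induction h with
  | nil => exact ⟨Equiv.refl _, fun _ => rfl, fun _ => rfl, fun _ => rfl⟩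
  | @cons v l l' _ ih =>
    obtain ⟨e, h1, h2, h3⟩ := ih
    let E := (consEquiv v l).symm.trans (((Equiv.refl _).sumCongr e).trans (consEquiv v l'))
    have E1 : ∀ p, E (consEquiv v l (.inl p)) = head v l' p := fun p => by
      simp only [E, Equiv.trans_apply, Equiv.sumCongr_apply, Sum.map_inl, Equiv.symm_apply_apply]; rfl
    have E2 : ∀ x, E (consEquiv v l (.inr x)) = tail v (e x) := fun x => by
      simp only [E, Equiv.trans_apply, Equiv.sumCongr_apply, Sum.map_inr, Equiv.symm_apply_apply]; rfl
    refine ⟨E, ?_, ?_, ?_⟩ <;> intro x <;> obtain ⟨p | x, rfl⟩ := (consEquiv v l).surjective x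
    all_goals first | rw [E1] | rw [E2]
    · rfl
    · exact h1 x
    · exact (E1 _).symm
    · exact (congrArg (tail v) (h2 x)).trans (E2 x.next).symm
    · exact (E1 _).symm
    · exact (congrArg (tail v) (h3 x)).trans (E2 x.opp).symm
  | swap v w l =>
    let e₁ := ((Equiv.refl (Fin w.arity)).sumCongr (consEquiv v l)).trans (consEquiv w (v :: l))
    let e₂ := ((Equiv.refl (Fin v.arity)).sumCongr (consEquiv w l)).trans (consEquiv v (w :: l))
    let s : Fin w.arity ⊕ Fin v.arity ⊕ Dart l ≃ Fin v.arity ⊕ Fin w.arity ⊕ Dart l :=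
      (Equiv.sumAssoc _ _ _).symm.trans (((Equiv.sumComm _ _).sumCongr (Equiv.refl _)).trans
        (Equiv.sumAssoc _ _ _))
    let e := e₁.symm.trans (s.trans e₂)
    have he : ∀ y, e (e₁ y) = e₂ (s y) := fun y => by simp [e]
    refine ⟨e, ?_, ?_, ?_⟩ <;> intro x <;> obtain ⟨p | q | x, rfl⟩ := e₁.surjective x
    all_goals rw [he]
    all_goals first | rfl | skip
    · exact (he (.inl (finRotate _ p))).symm
    · exact (he (.inr (.inl (finRotate _ q)))).symm
    · exact (he (.inr (.inr x.next))).symm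
    · exact (he (.inl ((finRotate _ ^ (w.arity / 2)) p))).symm
    · exact (he (.inr (.inl ((finRotate _ ^ (v.arity / 2)) q)))).symm
    · exact (he (.inr (.inr x.opp))).symm
  | trans _ _ ih₁ ih₂ =>
    obtain ⟨e, h1, h2, h3⟩ := ih₁
    obtain ⟨e', g1, g2, g3⟩ := ih₂
    exact ⟨e.trans e', fun x => by simp [g1, h1], fun x => by simp [g2, h2],
      fun x => by simp [g3, h3]⟩

end Dart

namespace DartSystem

theorem IsPlaneCurve.of_preserves {X Y : Type} {S : DartSystem X} {T : DartSystem Y} {v : ℕ}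
    {e : X ≃ Y} (he : Dart.Preserves S T e) : S.IsPlaneCurve v ↔ T.IsPlaneCurve v := by
  obtain ⟨h1, h2, h3⟩ := he
  refine ⟨.congr e h1 h2 h3, .congr e.symm ?_ ?_ ?_⟩ <;> intro y <;>
    obtain ⟨x, rfl⟩ := e.surjective y <;> simp [h1, h2, h3]

end DartSystem

/-! ### Presentations of a welded knot -/

namespace VirtualKnotDiagram

theorem isPlaneCurve (D : VirtualKnotDiagram) :
    (Dart.system D.nodes).IsPlaneCurve D.nodes.length :=
  ⟨D.edge_ends, D.one_component, D.planar⟩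

/-- The list presents a diagram of the knot `K`. -/
def _root_.WeldedKnot.Presents (K : WeldedKnot) (l : List DiagramNode) : Prop :=
  ∃ D : VirtualKnotDiagram, D.nodes = l ∧ D.toWeldedKnot = K

end VirtualKnotDiagram

namespace WeldedKnot

variable {K : WeldedKnot}

theorem Presents.isPlaneCurve {l : List DiagramNode} (h : K.Presents l) :
    (Dart.system l).IsPlaneCurve l.length := by
  obtain ⟨D, rfl, -⟩ := h
  exact D.isPlaneCurve

/-- The equivalence relates diagrams only, so along a chain of moves every intermediate list has to
be a plane closed curve; this is the sole obligation of a move. -/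
theorem Presents.of_move {l l' : List DiagramNode} (h : K.Presents l)
    (hm : WeldedMove l l' ∨ WeldedMove l' l) (hl' : (Dart.system l').IsPlaneCurve l'.length) :
    K.Presents l' := by
  obtain ⟨D, rfl, rfl⟩ := h
  refine ⟨⟨l', hl'.edge_ends, hl'.one_component, hl'.planar⟩, rfl, ?_⟩
  rcases hm with hm | hm
  · exact (Quot.sound (r := fun D D' : VirtualKnotDiagram => WeldedMove D.nodes D'.nodes) hm).symm
  · exact Quot.sound hm

theorem Presents.perm {l l' : List DiagramNode} (h : K.Presents l) (hl : l.Perm l') :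
    K.Presents l' := by
  refine h.of_move (.inl (.perm hl)) ?_
  obtain ⟨e, he⟩ := Dart.exists_equiv_perm hl
  rw [← hl.length_eq]
  exact (DartSystem.IsPlaneCurve.of_preserves he).1 h.isPlaneCurve

/-- The list `A` is a tangle in a disk with `n` ends and with labels below `N`. -/
structure _root_.DiskTangle (A : List DiagramNode) {n : ℕ} (N : ℕ) (nxt op : Fin n → Fin n) where
  m : ℕ
  tangle : (Dart.system A).Tangle m nxt op
  label_lt : ∀ d : Dart A, d.label < N
  euler : 2 * A.length + 2 * m + n = Nat.card (Dart A) + 2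

/-- The labels from `n` to `N - 1` are translated by `f` to labels that do not occur otherwise. -/
def _root_.FreshLabels (n N : ℕ) (f : ℕ → ℕ) (l : List DiagramNode) : Prop :=
  ∀ i, n ≤ i → i < N → (∀ j < N, f i = f j → i = j) ∧ f i ∉ edgeLabels l

theorem _root_.DiskTangle.fresh {A : List DiagramNode} {n N : ℕ} {nxt op : Fin n → Fin n}
    (t : DiskTangle A N nxt op) {f : ℕ → ℕ} {l : List DiagramNode} (h : FreshLabels n N f l) :
    DartSystem.Tangle.Fresh (Dart.system A) n f (Dart.system l) := by
  intro x hx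
  have hxN := t.label_lt x
  obtain ⟨h1, h2⟩ := h _ hx hxN
  refine ⟨fun j hj => h1 j ?_, fun y hy => h2 (Dart.mem_edgeLabels.2 ⟨y, hy⟩)⟩
  rcases hj with hj | ⟨d, rfl⟩
  · exact hj.trans (hx.trans_lt hxN)
  · exact t.label_lt d

/-- A move that exchanges two tangles in a disk with the same ends leads to a diagram of the same
knot. -/
theorem Presents.exchange {A B A' B' L L' l : List DiagramNode} {n N N' : ℕ}
    {nxt op : Fin n → Fin n}
    (tA : DiskTangle A N nxt op) (tB : DiskTangle B N' nxt op) {f : ℕ → ℕ}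
    (hA : List.Forall₂ (DiagramNode.Shape f) A A') (hB : List.Forall₂ (DiagramNode.Shape f) B B')
    (hfA : FreshLabels n N f l) (hfB : FreshLabels n N' f l)
    (hL : L.Perm (A' ++ l)) (hL' : (B' ++ l).Perm L') (hm : WeldedMove L L' ∨ WeldedMove L' L)
    (h : K.Presents L) : K.Presents L' := by
  refine h.of_move hm ?_
  obtain ⟨e₀, he₀⟩ := Dart.exists_equiv_perm hL
  obtain ⟨e₁, he₁⟩ := Dart.exists_equiv_perm hL'
  obtain ⟨e, he⟩ := Dart.exists_equiv_append hA l
  obtain ⟨e', he'⟩ := Dart.exists_equiv_append hB l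
  have h1 := h.isPlaneCurve
  rw [DartSystem.IsPlaneCurve.of_preserves he₀, hL.length_eq,
    ← DartSystem.IsPlaneCurve.of_preserves he, List.length_append, ← hA.length_eq] at h1
  rw [← DartSystem.IsPlaneCurve.of_preserves he₁, ← hL'.length_eq,
    ← DartSystem.IsPlaneCurve.of_preserves he', List.length_append, ← hB.length_eq]
  exact tA.tangle.isPlaneCurve_exchange tB.tangle tA.euler tB.euler (tA.fresh hfA) (tB.fresh hfB) h1

end WeldedKnot

/-! ### Certificates for the tangles in the moves -/

/-- A single crossing. -/
def crossingTangle : DiskTangle (n := 4) [.crossing .virt 0 1 2 3]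
    4 (· + 1) (· + 2) where
  m := 0
  tangle :=
    { bd := ![⟨⟨0, by decide⟩, ⟨0, by decide⟩⟩, ⟨⟨0, by decide⟩, ⟨1, by decide⟩⟩, ⟨⟨0, by decide⟩, ⟨2, by decide⟩⟩, ⟨⟨0, by decide⟩, ⟨3, by decide⟩⟩]
      face := fun d => (([[.inl 0, .inl 1, .inl 2, .inl 3]] : List (List (Fin 4 ⊕ Fin 0))).getD d.1 []).getD d.2 (.inl 0)
      rep := ![]
      arc := fun d => (([[0, 1, 0, 1]] : List (List (Fin 4))).getD d.1 []).getD d.2 (0)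
      faceRank := fun d => (([[0, 0, 0, 0]] : List (List (ℕ))).getD d.1 []).getD d.2 (0)
      arcRank := fun d => (([[0, 0, 1, 1]] : List (List (ℕ))).getD d.1 []).getD d.2 (0)
      bd_label := by decide +kernel
      bd_unique := by decide +kernel
      inner_edge := by decide +kernel
      face_bd := by decide +kernel
      face_rep := by decide +kernel
      face_step := by decide +kernel
      face_exit := by decide +kernel
      exit := by decide +kernel
      face_rank := by decide +kernel
      arc_edge := by decide +kernel
      arc_opp := by decide +kernel
      arc_bd := by decide +kernel
      arc_op := by decide +kernel
      arc_rank := by decide +kernel }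
  label_lt := by decide +kernel
  euler := by rw [Nat.card_eq_fintype_card]; decide +kernel

/-- A single crossing, read from the next slot on. -/
def rotatedCrossingTangle : DiskTangle (n := 4) [.crossing .virt 1 2 3 0]
    4 (· + 1) (· + 2) where
  m := 0
  tangle :=
    { bd := ![⟨⟨0, by decide⟩, ⟨3, by decide⟩⟩, ⟨⟨0, by decide⟩, ⟨0, by decide⟩⟩, ⟨⟨0, by decide⟩, ⟨1, by decide⟩⟩, ⟨⟨0, by decide⟩, ⟨2, by decide⟩⟩]
      face := fun d => (([[.inl 1, .inl 2, .inl 3, .inl 0]] : List (List (Fin 4 ⊕ Fin 0))).getD d.1 []).getD d.2 (.inl 0)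
      rep := ![]
      arc := fun d => (([[1, 0, 1, 0]] : List (List (Fin 4))).getD d.1 []).getD d.2 (0)
      faceRank := fun d => (([[0, 0, 0, 0]] : List (List (ℕ))).getD d.1 []).getD d.2 (0)
      arcRank := fun d => (([[0, 1, 1, 0]] : List (List (ℕ))).getD d.1 []).getD d.2 (0)
      bd_label := by decide +kernel
      bd_unique := by decide +kernel
      inner_edge := by decide +kernel
      face_bd := by decide +kernel
      face_rep := by decide +kernel
      face_step := by decide +kernel
      face_exit := by decide +kernel
      exit := by decide +kernel
      face_rank := by decide +kernel
      arc_edge := by decide +kernel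
      arc_opp := by decide +kernel
      arc_bd := by decide +kernel
      arc_op := by decide +kernel
      arc_rank := by decide +kernel }
  label_lt := by decide +kernel
  euler := by rw [Nat.card_eq_fintype_card]; decide +kernel

/-- A crossing with a point on one of its edges. -/
def subdividedCrossingTangle : DiskTangle (n := 4) [.point 0 4, .crossing .virt 4 1 2 3]
    5 (· + 1) (· + 2) where
  m := 0
  tangle :=
    { bd := ![⟨⟨0, by decide⟩, ⟨0, by decide⟩⟩, ⟨⟨1, by decide⟩, ⟨1, by decide⟩⟩, ⟨⟨1, by decide⟩, ⟨2, by decide⟩⟩, ⟨⟨1, by decide⟩, ⟨3, by decide⟩⟩]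
      face := fun d => (([[.inl 0, .inl 3], [.inl 0, .inl 1, .inl 2, .inl 3]] : List (List (Fin 4 ⊕ Fin 0))).getD d.1 []).getD d.2 (.inl 0)
      rep := ![]
      arc := fun d => (([[0, 0], [0, 1, 0, 1]] : List (List (Fin 4))).getD d.1 []).getD d.2 (0)
      faceRank := fun d => (([[0, 1], [1, 0, 0, 0]] : List (List (ℕ))).getD d.1 []).getD d.2 (0)
      arcRank := fun d => (([[0, 1], [2, 0, 3, 1]] : List (List (ℕ))).getD d.1 []).getD d.2 (0)
      bd_label := by decide +kernel
      bd_unique := by decide +kernel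
      inner_edge := by decide +kernel
      face_bd := by decide +kernel
      face_rep := by decide +kernel
      face_step := by decide +kernel
      face_exit := by decide +kernel
      exit := by decide +kernel
      face_rank := by decide +kernel
      arc_edge := by decide +kernel
      arc_opp := by decide +kernel
      arc_bd := by decide +kernel
      arc_op := by decide +kernel
      arc_rank := by decide +kernel }
  label_lt := by decide +kernel
  euler := by rw [Nat.card_eq_fintype_card]; decide +kernel

/-- A single point. -/
def pointTangle : DiskTangle (n := 2) [.point 0 1]
    2 (· + 1) (· + 1) where
  m := 0
  tangle :=
    { bd := ![⟨⟨0, by decide⟩, ⟨0, by decide⟩⟩, ⟨⟨0, by decide⟩, ⟨1, by decide⟩⟩]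
      face := fun d => (([[.inl 0, .inl 1]] : List (List (Fin 2 ⊕ Fin 0))).getD d.1 []).getD d.2 (.inl 0)
      rep := ![]
      arc := fun d => (([[0, 0]] : List (List (Fin 2))).getD d.1 []).getD d.2 (0)
      faceRank := fun d => (([[0, 0]] : List (List (ℕ))).getD d.1 []).getD d.2 (0)
      arcRank := fun d => (([[0, 1]] : List (List (ℕ))).getD d.1 []).getD d.2 (0)
      bd_label := by decide +kernel
      bd_unique := by decide +kernel
      inner_edge := by decide +kernel
      face_bd := by decide +kernel
      face_rep := by decide +kernel
      face_step := by decide +kernel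
      face_exit := by decide +kernel
      exit := by decide +kernel
      face_rank := by decide +kernel
      arc_edge := by decide +kernel
      arc_opp := by decide +kernel
      arc_bd := by decide +kernel
      arc_op := by decide +kernel
      arc_rank := by decide +kernel }
  label_lt := by decide +kernel
  euler := by rw [Nat.card_eq_fintype_card]; decide +kernel

/-- A single point, read in the other direction. -/
def rotatedPointTangle : DiskTangle (n := 2) [.point 1 0]
    2 (· + 1) (· + 1) where
  m := 0
  tangle :=
    { bd := ![⟨⟨0, by decide⟩, ⟨1, by decide⟩⟩, ⟨⟨0, by decide⟩, ⟨0, by decide⟩⟩]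
      face := fun d => (([[.inl 1, .inl 0]] : List (List (Fin 2 ⊕ Fin 0))).getD d.1 []).getD d.2 (.inl 0)
      rep := ![]
      arc := fun d => (([[0, 0]] : List (List (Fin 2))).getD d.1 []).getD d.2 (0)
      faceRank := fun d => (([[0, 0]] : List (List (ℕ))).getD d.1 []).getD d.2 (0)
      arcRank := fun d => (([[1, 0]] : List (List (ℕ))).getD d.1 []).getD d.2 (0)
      bd_label := by decide +kernel
      bd_unique := by decide +kernel
      inner_edge := by decide +kernel
      face_bd := by decide +kernel
      face_rep := by decide +kernel
      face_step := by decide +kernel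
      face_exit := by decide +kernel
      exit := by decide +kernel
      face_rank := by decide +kernel
      arc_edge := by decide +kernel
      arc_opp := by decide +kernel
      arc_bd := by decide +kernel
      arc_op := by decide +kernel
      arc_rank := by decide +kernel }
  label_lt := by decide +kernel
  euler := by rw [Nat.card_eq_fintype_card]; decide +kernel

/-- A kink. -/
def kinkTangle : DiskTangle (n := 2) [.crossing .virt 2 2 0 1]
    3 (· + 1) (· + 1) where
  m := 1
  tangle :=
    { bd := ![⟨⟨0, by decide⟩, ⟨2, by decide⟩⟩, ⟨⟨0, by decide⟩, ⟨3, by decide⟩⟩]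
      face := fun d => (([[.inr 0, .inl 1, .inl 0, .inl 1]] : List (List (Fin 2 ⊕ Fin 1))).getD d.1 []).getD d.2 (.inl 0)
      rep := ![⟨⟨0, by decide⟩, ⟨0, by decide⟩⟩]
      arc := fun d => (([[0, 0, 0, 0]] : List (List (Fin 2))).getD d.1 []).getD d.2 (0)
      faceRank := fun d => (([[0, 1, 0, 0]] : List (List (ℕ))).getD d.1 []).getD d.2 (0)
      arcRank := fun d => (([[1, 2, 0, 3]] : List (List (ℕ))).getD d.1 []).getD d.2 (0)
      bd_label := by decide +kernel
      bd_unique := by decide +kernel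
      inner_edge := by decide +kernel
      face_bd := by decide +kernel
      face_rep := by decide +kernel
      face_step := by decide +kernel
      face_exit := by decide +kernel
      exit := by decide +kernel
      face_rank := by decide +kernel
      arc_edge := by decide +kernel
      arc_opp := by decide +kernel
      arc_bd := by decide +kernel
      arc_op := by decide +kernel
      arc_rank := by decide +kernel }
  label_lt := by decide +kernel
  euler := by rw [Nat.card_eq_fintype_card]; decide +kernel

/-- Two adjacent crossings, with points on two edges that leave them on the same side. -/
def adjacentCrossingsTangle : DiskTangle (n := 6) [.point 2 7, .point 1 8, .crossing .virt 7 3 4 6, .crossing .virt 8 6 5 0]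
    11 (· + 1) ![3, 5, 4, 0, 2, 1] where
  m := 0
  tangle :=
    { bd := ![⟨⟨3, by decide⟩, ⟨3, by decide⟩⟩, ⟨⟨1, by decide⟩, ⟨0, by decide⟩⟩, ⟨⟨0, by decide⟩, ⟨0, by decide⟩⟩, ⟨⟨2, by decide⟩, ⟨1, by decide⟩⟩, ⟨⟨2, by decide⟩, ⟨2, by decide⟩⟩, ⟨⟨3, by decide⟩, ⟨2, by decide⟩⟩]
      face := fun d => (([[.inl 2, .inl 1], [.inl 1, .inl 0], [.inl 2, .inl 3, .inl 4, .inl 1], [.inl 1, .inl 4, .inl 5, .inl 0]] : List (List (Fin 6 ⊕ Fin 0))).getD d.1 []).getD d.2 (.inl 0)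
      rep := ![]
      arc := fun d => (([[2, 2], [1, 1], [2, 0, 2, 0], [1, 0, 1, 0]] : List (List (Fin 6))).getD d.1 []).getD d.2 (0)
      faceRank := fun d => (([[0, 3], [0, 1], [1, 0, 0, 2], [1, 1, 0, 0]] : List (List (ℕ))).getD d.1 []).getD d.2 (0)
      arcRank := fun d => (([[0, 1], [0, 1], [2, 3, 3, 2], [2, 1, 3, 0]] : List (List (ℕ))).getD d.1 []).getD d.2 (0)
      bd_label := by decide +kernel
      bd_unique := by decide +kernel
      inner_edge := by decide +kernel
      face_bd := by decide +kernel
      face_rep := by decide +kernel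
      face_step := by decide +kernel
      face_exit := by decide +kernel
      exit := by decide +kernel
      face_rank := by decide +kernel
      arc_edge := by decide +kernel
      arc_opp := by decide +kernel
      arc_bd := by decide +kernel
      arc_op := by decide +kernel
      arc_rank := by decide +kernel }
  label_lt := by decide +kernel
  euler := by rw [Nat.card_eq_fintype_card]; decide +kernel

/-- The edges with points have been pushed over each other. -/
def fingerTangle : DiskTangle (n := 6) [.crossing .virt 9 10 7 8, .crossing .virt 7 3 4 6, .crossing .virt 8 6 5 0, .crossing .virt 10 9 1 2]
    11 (· + 1) ![3, 5, 4, 0, 2, 1] where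
  m := 2
  tangle :=
    { bd := ![⟨⟨2, by decide⟩, ⟨3, by decide⟩⟩, ⟨⟨3, by decide⟩, ⟨2, by decide⟩⟩, ⟨⟨3, by decide⟩, ⟨3, by decide⟩⟩, ⟨⟨1, by decide⟩, ⟨1, by decide⟩⟩, ⟨⟨1, by decide⟩, ⟨2, by decide⟩⟩, ⟨⟨2, by decide⟩, ⟨2, by decide⟩⟩]
      face := fun d => (([[.inr 0, .inl 2, .inr 1, .inl 0], [.inl 2, .inl 3, .inl 4, .inr 1], [.inr 1, .inl 4, .inl 5, .inl 0], [.inr 0, .inl 0, .inl 1, .inl 2]] : List (List (Fin 6 ⊕ Fin 2))).getD d.1 []).getD d.2 (.inl 0)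
      rep := ![⟨⟨0, by decide⟩, ⟨0, by decide⟩⟩, ⟨⟨0, by decide⟩, ⟨2, by decide⟩⟩]
      arc := fun d => (([[2, 1, 2, 1], [2, 0, 2, 0], [1, 0, 1, 0], [1, 2, 1, 2]] : List (List (Fin 6))).getD d.1 []).getD d.2 (0)
      faceRank := fun d => (([[0, 1, 0, 1], [2, 0, 0, 2], [1, 1, 0, 0], [1, 2, 0, 0]] : List (List (ℕ))).getD d.1 []).getD d.2 (0)
      arcRank := fun d => (([[2, 2, 3, 3], [4, 3, 5, 2], [4, 1, 5, 0], [1, 1, 0, 0]] : List (List (ℕ))).getD d.1 []).getD d.2 (0)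
      bd_label := by decide +kernel
      bd_unique := by decide +kernel
      inner_edge := by decide +kernel
      face_bd := by decide +kernel
      face_rep := by decide +kernel
      face_step := by decide +kernel
      face_exit := by decide +kernel
      exit := by decide +kernel
      face_rank := by decide +kernel
      arc_edge := by decide +kernel
      arc_opp := by decide +kernel
      arc_bd := by decide +kernel
      arc_op := by decide +kernel
      arc_rank := by decide +kernel }
  label_lt := by decide +kernel
  euler := by rw [Nat.card_eq_fintype_card]; decide +kernel

/-- The strand that met the second crossing has been pushed across the first one. -/
def pushedTangle : DiskTangle (n := 6) [.crossing .virt 7 8 4 5, .crossing .virt 9 6 7 0, .crossing .virt 10 3 8 6, .crossing .virt 10 9 1 2]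
    11 (· + 1) ![3, 5, 4, 0, 2, 1] where
  m := 2
  tangle :=
    { bd := ![⟨⟨1, by decide⟩, ⟨3, by decide⟩⟩, ⟨⟨3, by decide⟩, ⟨2, by decide⟩⟩, ⟨⟨3, by decide⟩, ⟨3, by decide⟩⟩, ⟨⟨2, by decide⟩, ⟨1, by decide⟩⟩, ⟨⟨0, by decide⟩, ⟨2, by decide⟩⟩, ⟨⟨0, by decide⟩, ⟨3, by decide⟩⟩]
      face := fun d => (([[.inr 0, .inl 3, .inl 4, .inl 5], [.inr 1, .inr 0, .inl 5, .inl 0], [.inl 2, .inl 3, .inr 0, .inr 1], [.inr 1, .inl 0, .inl 1, .inl 2]] : List (List (Fin 6 ⊕ Fin 2))).getD d.1 []).getD d.2 (.inl 0)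
      rep := ![⟨⟨0, by decide⟩, ⟨0, by decide⟩⟩, ⟨⟨1, by decide⟩, ⟨0, by decide⟩⟩]
      arc := fun d => (([[2, 1, 2, 1], [2, 0, 2, 0], [1, 0, 1, 0], [1, 2, 1, 2]] : List (List (Fin 6))).getD d.1 []).getD d.2 (0)
      faceRank := fun d => (([[0, 1, 0, 0], [0, 2, 1, 0], [1, 0, 1, 1], [2, 1, 0, 0]] : List (List (ℕ))).getD d.1 []).getD d.2 (0)
      arcRank := fun d => (([[4, 4, 5, 5], [2, 1, 3, 0], [2, 3, 3, 2], [1, 1, 0, 0]] : List (List (ℕ))).getD d.1 []).getD d.2 (0)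
      bd_label := by decide +kernel
      bd_unique := by decide +kernel
      inner_edge := by decide +kernel
      face_bd := by decide +kernel
      face_rep := by decide +kernel
      face_step := by decide +kernel
      face_exit := by decide +kernel
      exit := by decide +kernel
      face_rank := by decide +kernel
      arc_edge := by decide +kernel
      arc_opp := by decide +kernel
      arc_bd := by decide +kernel
      arc_op := by decide +kernel
      arc_rank := by decide +kernel }
  label_lt := by decide +kernel
  euler := by rw [Nat.card_eq_fintype_card]; decide +kernel

/-! ### Moves between presentations -/

namespace DiagramNode

/-- The same node, read from the next slot on. -/
def rotate : DiagramNode → DiagramNode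
  | point a b => point b a
  | crossing k a b c d => crossing k.swap b c d a

end DiagramNode

theorem edgeLabels_cons (v : DiagramNode) (l : List DiagramNode) :
    edgeLabels (v :: l) = v.labels ++ edgeLabels l := rfl

namespace WeldedKnot

variable {K : WeldedKnot}

theorem Presents.rotate {v : DiagramNode} {l : List DiagramNode} (h : K.Presents (v :: l)) :
    K.Presents (v.rotate :: l) := by
  cases v with
  | point a b =>
    refine h.exchange (l := l) pointTangle rotatedPointTangle (f := fun i => [a, b].getD i 0)
      (.cons (.point 0 1) .nil) (.cons (.point 1 0) .nil) ?_ ?_ (.refl _) (.refl _)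
      (.inl (.rotatePoint a b l)) <;> intro i h1 h2 <;> omega
  | crossing k a b c d =>
    refine h.exchange (l := l) crossingTangle rotatedCrossingTangle
      (f := fun i => [a, b, c, d].getD i 0)
      (.cons (.crossing .virt k 0 1 2 3) .nil) (.cons (.crossing .virt k.swap 1 2 3 0) .nil)
      ?_ ?_ (.refl _) (.refl _) (.inl (.rotateCrossing k a b c d l)) <;> intro i h1 h2 <;> omega

/-- Here `bs` labels the ends and `cs` the inner edges. Repetitions within `bs` are allowed, since
two ends of the tangle may be joined directly outside. -/
theorem freshLabels_getD {n N : ℕ} {l : List DiagramNode} {bs cs : List ℕ} (hn : bs.length = n)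
    (hN : n + cs.length = N) (hc : cs.Nodup) (hbc : ∀ x ∈ cs, x ∉ bs)
    (hl : ∀ x ∈ cs, x ∉ edgeLabels l) : FreshLabels n N (fun i => (bs ++ cs).getD i 0) l := by
  intro i h1 h2
  have hi : i - n < cs.length := by omega
  have hfi : (bs ++ cs).getD i 0 = cs[i - n] := by
    rw [List.getD_eq_getElem _ _ (by simp; omega), List.getElem_append_right (by omega)]
    simp [hn]
  refine ⟨fun j hj h => ?_, by simpa only [hfi] using hl _ (List.getElem_mem _)⟩
  simp only [hfi] at h
  by_cases hjn : j < n
  · rw [List.getD_eq_getElem _ _ (by simp; omega), List.getElem_append_left (by omega)] at h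
    exact absurd (h ▸ List.getElem_mem _) (hbc _ (List.getElem_mem hi))
  · rw [List.getD_eq_getElem _ _ (by simp; omega), List.getElem_append_right (by omega)] at h
    have := (List.Nodup.getElem_inj_iff hc).1 h
    omega

theorem Presents.subdivide_iff {k : CrossingKind} {a b x y z : ℕ} {l : List DiagramNode}
    (hb : b ∉ [a, x, y, z]) (hl : b ∉ edgeLabels l) :
    K.Presents (.crossing k a x y z :: l) ↔
      K.Presents (.point a b :: .crossing k b x y z :: l) := by
  have hA : List.Forall₂ (DiagramNode.Shape fun i => ([a, x, y, z] ++ [b]).getD i 0)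
    [.crossing .virt 0 1 2 3] [.crossing k a x y z] := .cons (.crossing .virt k 0 1 2 3) .nil
  have hB : List.Forall₂ (DiagramNode.Shape fun i => ([a, x, y, z] ++ [b]).getD i 0)
    [.point 0 4, .crossing .virt 4 1 2 3] [.point a b, .crossing k b x y z] :=
    .cons (.point 0 4) (.cons (.crossing .virt k 4 1 2 3) .nil)
  have hfB : FreshLabels 4 5 (fun i => ([a, x, y, z] ++ [b]).getD i 0) l :=
    freshLabels_getD rfl rfl (by simp) (by simpa using hb) (by simpa using hl)
  have hfA : FreshLabels 4 4 (fun i => ([a, x, y, z] ++ [b]).getD i 0) l := by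
    intro i h1 h2; omega
  exact ⟨fun h => h.exchange crossingTangle subdividedCrossingTangle hA hB hfA hfB (.refl _)
      (.refl _) (.inl (.subdivideCrossing k a b x y z l)),
    fun h => h.exchange subdividedCrossingTangle crossingTangle hB hA hfB hfA (.refl _)
      (.refl _) (.inr (.subdivideCrossing k a b x y z l))⟩

theorem Presents.kink {k : CrossingKind} {a b c : ℕ} {l : List DiagramNode} (ha : a ∉ [b, c])
    (hl : a ∉ edgeLabels l) (h : K.Presents (.point b c :: l)) :
    K.Presents (.crossing k a a b c :: l) := by
  refine h.exchange (l := l) pointTangle kinkTangle (f := fun i => ([b, c] ++ [a]).getD i 0)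
    (.cons (.point 0 1) .nil) (.cons (.crossing .virt k 2 2 0 1) .nil) ?_ ?_ (.refl _) (.refl _)
    (.inl (.reidemeister₁ k a b c l))
  · intro i h1 h2; omega
  · exact freshLabels_getD rfl rfl (by simp) (by simpa using ha) (by simpa using hl)

/-- Let two crossings be joined by the edge `p`, at which one passes under at the first crossing and
not under at the second one. Then the other strand `w₁w₂` at the second crossing may be pushed
across the first crossing. -/
theorem Presents.push {k : CrossingKind} (hk : k ≠ .firstOver) {o₁ i o₂ p w₁ w₂ y a b e f : ℕ}
    {l : List DiagramNode} (hnew : [p, a, b, e, f].Nodup)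
    (hout : ∀ x ∈ [p, a, b, e, f], x ∉ [y, w₁, o₁, i, o₂, w₂])
    (hl : ∀ x ∈ [p, a, b, e, f], x ∉ edgeLabels l)
    (h : K.Presents (.crossing .firstOver o₁ i o₂ p :: .crossing k w₁ p w₂ y :: l)) :
    K.Presents (.crossing k.swap a b o₂ w₂ :: .crossing .firstOver e p a y ::
      .crossing k f i b p :: .crossing k f e w₁ o₁ :: l) := by
  have hfresh : FreshLabels 6 11
      (fun j => ([y, w₁, o₁, i, o₂, w₂] ++ [p, a, b, e, f]).getD j 0) l :=
    freshLabels_getD rfl rfl hnew hout hl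
  simp only [List.nodup_cons, List.mem_cons, List.not_mem_nil, or_false, not_or, List.nodup_nil,
    and_true, not_false_eq_true, forall_eq_or_imp, forall_eq] at hnew hout hl
  obtain ⟨hn1, hn2, hn3, hn4⟩ := hnew
  obtain ⟨ho1, ho2, ho3, ho4, ho5⟩ := hout
  obtain ⟨hl1, hl2, hl3, hl4, hl5⟩ := hl
  -- The edges `o₁` and `w₁`, which leave the two crossings on the same side of `p`, get auxiliary
  -- points: the second Reidemeister move acts on two points.
  rw [Presents.subdivide_iff (b := a) (by simp; tauto)
    (by simp [edgeLabels_cons, DiagramNode.labels]; tauto)] at h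
  have h := h.perm (List.perm_middle (l₁ := [_, _]))
  rw [List.cons_append, Presents.subdivide_iff (b := b) (by simp; tauto)
    (by simp [edgeLabels_cons, DiagramNode.labels]; tauto)] at h
  have h := (h.perm (List.perm_middle (l₁ := [_, _]))).perm
    (((List.Perm.swap _ _ _).cons _).cons _)
  -- Second Reidemeister move: the strand of `w₁` makes a finger across `o₁`, under it or virtually,
  -- as it crosses `p`. This creates the triangle `a`, `b`, `p`.
  have h := h.exchange (l := l) adjacentCrossingsTangle fingerTangle
    (f := fun j => ([y, w₁, o₁, i, o₂, w₂] ++ [p, a, b, e, f]).getD j 0)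
    (B' := [.crossing k.swap e f a b, .crossing .firstOver a i o₂ p, .crossing k b p w₂ y,
      .crossing k f e w₁ o₁])
    (.cons (.point 2 7) (.cons (.point 1 8) (.cons (.crossing _ _ 7 3 4 6)
      (.cons (.crossing _ _ 8 6 5 0) .nil))))
    (.cons (.crossing _ _ 9 10 7 8) (.cons (.crossing _ _ 7 3 4 6) (.cons (.crossing _ _ 8 6 5 0)
      (.cons (.crossing _ _ 10 9 1 2) .nil))))
    hfresh hfresh (.refl _) (List.perm_middle (l₁ := [_, _, _]))
    (.inl (.reidemeister₂ k e o₁ a f w₁ b _))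
  have h := h.perm (List.perm_middle (l₁ := [_, _, _])).symm
  -- The triangle `a`, `b`, `p` is flipped. In the classical case the overstrand `o` is on top, the
  -- strand of `p` and `y` in the middle and `w` at the bottom; otherwise `w` has only virtual
  -- crossings here and the mixed move applies.
  refine h.exchange (l := l) fingerTangle pushedTangle
    (f := fun j => ([y, w₁, o₁, i, o₂, w₂] ++ [p, a, b, e, f]).getD j 0)
    (.cons (.crossing _ _ 9 10 7 8) (.cons (.crossing _ _ 7 3 4 6) (.cons (.crossing _ _ 8 6 5 0)
      (.cons (.crossing _ _ 10 9 1 2) .nil))))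
    (.cons (.crossing _ _ 7 8 4 5) (.cons (.crossing _ _ 9 6 7 0) (.cons (.crossing _ _ 10 3 8 6)
      (.cons (.crossing _ _ 10 9 1 2) .nil))))
    hfresh hfresh (.refl _) (.refl _) (.inr (.triangle _ _ _ ?_ _ _ _ _ _ _ _ _ _ _))
  cases k with
  | firstOver => exact absurd rfl hk
  | secondOver =>
    refine TriangleMove.classical _ _ _ ?_ ?_ ?_ ?_ <;> simp [CrossingKind.swap]
  | virt => exact .mixed₁ _ (by simp)

end WeldedKnot

/-! ### Over, under and straight passages in terms of edge labels -/

namespace DiagramNode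

/-- One passes from `x` straight to `y` without passing under. -/
def Links : DiagramNode → ℕ → ℕ → Prop
  | point a b, x, y => (x = a ∧ y = b) ∨ (x = b ∧ y = a)
  | crossing .firstOver a _ c _, x, y => (x = a ∧ y = c) ∨ (x = c ∧ y = a)
  | crossing .secondOver _ b _ d, x, y => (x = b ∧ y = d) ∨ (x = d ∧ y = b)
  | crossing .virt a b c d, x, y =>
      ((x = a ∧ y = c) ∨ (x = c ∧ y = a)) ∨ (x = b ∧ y = d) ∨ (x = d ∧ y = b)

/-- The edge `x` is over at this node. -/
def HasOver : DiagramNode → ℕ → Prop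
  | crossing .firstOver a _ c _, x => x = a ∨ x = c
  | crossing .secondOver _ b _ d, x => x = b ∨ x = d
  | _, _ => False

/-- The edges `u` and `u'` are opposite and under at this node. -/
def HasUnder : DiagramNode → ℕ → ℕ → Prop
  | crossing .firstOver _ b _ d, u, u' => (u = b ∧ u' = d) ∨ (u = d ∧ u' = b)
  | crossing .secondOver a _ c _, u, u' => (u = a ∧ u' = c) ∨ (u = c ∧ u' = a)
  | _, _, _ => False

/-- Counts the ends of edges in the set where `t = 1`, disregarding ends at undercrossings, where
crossings of such edges with each other count more. -/
def weight (t : ℕ → ℕ) : DiagramNode → ℕ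
  | point a b => t a + t b
  | crossing .firstOver a _ c _ => t a + t c
  | crossing .secondOver _ b _ d => t b + t d
  | crossing .virt a b c d => t a + t c + (t b + t d) + (t a + t c) * (t b + t d)

theorem links_rotate {v : DiagramNode} {x y : ℕ} : v.rotate.Links x y ↔ v.Links x y := by
  rcases v with _ | ⟨_ | _ | _, _, _, _, _⟩ <;> simp only [rotate, CrossingKind.swap, Links] <;>
    tauto

theorem hasOver_rotate {v : DiagramNode} {x : ℕ} : v.rotate.HasOver x ↔ v.HasOver x := by
  rcases v with _ | ⟨_ | _ | _, _, _, _, _⟩ <;> simp only [rotate, CrossingKind.swap, HasOver] <;>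
    tauto

theorem hasUnder_rotate {v : DiagramNode} {x y : ℕ} :
    v.rotate.HasUnder x y ↔ v.HasUnder x y := by
  rcases v with _ | ⟨_ | _ | _, _, _, _, _⟩ <;> simp only [rotate, CrossingKind.swap, HasUnder] <;>
    tauto

theorem mem_labels_rotate {v : DiagramNode} {x : ℕ} : x ∈ v.rotate.labels ↔ x ∈ v.labels := by
  rcases v with _ | ⟨_ | _ | _, _, _, _, _⟩ <;> simp only [rotate, labels, List.mem_cons] <;>
    tauto

theorem weight_rotate {v : DiagramNode} {t : ℕ → ℕ} : v.rotate.weight t = v.weight t := by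
  rcases v with _ | ⟨_ | _ | _, _, _, _, _⟩ <;> simp only [rotate, CrossingKind.swap, weight] <;>
    ring

theorem Links.mem_labels {v : DiagramNode} {x y : ℕ} (h : v.Links x y) :
    x ∈ v.labels ∧ y ∈ v.labels := by
  rcases v with _ | ⟨_ | _ | _, _, _, _, _⟩ <;> simp only [Links] at h <;>
    simp only [labels, List.mem_cons] <;> tauto

theorem HasOver.mem_labels {v : DiagramNode} {x : ℕ} (h : v.HasOver x) : x ∈ v.labels := by
  rcases v with _ | ⟨_ | _ | _, _, _, _, _⟩ <;> simp only [HasOver] at h <;>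
    simp only [labels, List.mem_cons] <;> tauto

theorem HasUnder.mem_labels {v : DiagramNode} {x y : ℕ} (h : v.HasUnder x y) :
    x ∈ v.labels ∧ y ∈ v.labels := by
  rcases v with _ | ⟨_ | _ | _, _, _, _, _⟩ <;> simp only [HasUnder] at h <;>
    simp only [labels, List.mem_cons] <;> tauto

/-- The normal form in which a strand begins: the overstrand takes slots `0` and `2`, and the strand
that starts here leaves through slot `3`. -/
theorem exists_rotate_eq_crossing {v : DiagramNode} {o u u' : ℕ} (ho : v.HasOver o)
    (hu : v.HasUnder u u') : ∃ (t : ℕ) (o₁ o₂ : ℕ), rotate^[t] v = crossing .firstOver o₁ u' o₂ u ∧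
      (o = o₁ ∨ o = o₂) := by
  rcases v with _ | ⟨_ | _ | _, a, b, c, d⟩ <;> simp only [HasOver, HasUnder] at ho hu
  · rcases hu with ⟨rfl, rfl⟩ | ⟨rfl, rfl⟩
    · exact ⟨2, c, a, rfl, ho.symm⟩
    · exact ⟨0, a, c, rfl, ho⟩
  · rcases hu with ⟨rfl, rfl⟩ | ⟨rfl, rfl⟩
    · exact ⟨1, b, d, rfl, ho⟩
    · exact ⟨3, d, b, rfl, ho.symm⟩

theorem exists_rotate_eq {v : DiagramNode} {p : ℕ} (hp : p ∈ v.labels) :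
    (∃ (t : ℕ) (y : ℕ), rotate^[t] v = point y p) ∨
      ∃ (t : ℕ) (k : CrossingKind) (w₁ w₂ y : ℕ), rotate^[t] v = crossing k w₁ p w₂ y := by
  rcases v with ⟨a, b⟩ | ⟨k, a, b, c, d⟩
  · left
    simp only [labels, List.mem_cons, List.not_mem_nil, or_false] at hp
    rcases hp with rfl | rfl
    · exact ⟨1, b, rfl⟩
    · exact ⟨0, a, rfl⟩
  · right
    simp only [labels, List.mem_cons, List.not_mem_nil, or_false] at hp
    rcases hp with rfl | rfl | rfl | rfl
    · exact ⟨3, _, d, b, c, rfl⟩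
    · exact ⟨0, _, a, c, d, rfl⟩
    · exact ⟨1, _, b, d, a, rfl⟩
    · exact ⟨2, _, c, a, b, rfl⟩

end DiagramNode

/-! ### Levels of strands -/

/-- The edges `x` and `y` meet at a node where one does not pass under. -/
def Linked (l : List DiagramNode) (x y : ℕ) : Prop := ∃ v ∈ l, v.Links x y

/-- The strand that contains the edge `x`. -/
def strandOf (l : List DiagramNode) (x : ℕ) : Quot (Linked l) := Quot.mk _ x

/-- The level `h` of edges is constant on strands. Strands with overcrossings have levels at most
`H`. Those with a level between `1` and `H` begin at a crossing where the other two strands have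
lower level, and there are at most `k` strands of level `0`. -/
structure Ranked (l : List DiagramNode) (h : ℕ → ℕ) (H k : ℕ) : Prop where
  coherent : ∀ v ∈ l, ∀ x y, v.Links x y → h x = h y
  over_le : ∀ v ∈ l, ∀ x, v.HasOver x → h x ≤ H
  parent : ∀ x ∈ edgeLabels l, 0 < h x → h x ≤ H → ∃ v ∈ l, ∃ o u u', v.HasOver o ∧
    v.HasUnder u u' ∧ h o < h u ∧ h u' < h u ∧ strandOf l x = strandOf l u
  seeds : ∃ S : Finset ℕ, S.card ≤ k ∧ ∀ x ∈ edgeLabels l, h x = 0 →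
    ∃ s ∈ S, strandOf l x = strandOf l s

theorem mem_edgeLabels {l : List DiagramNode} {x : ℕ} :
    x ∈ edgeLabels l ↔ ∃ v ∈ l, x ∈ v.labels := List.mem_flatMap

theorem strandOf_eq_of_map {l l' : List DiagramNode} {φ : ℕ → ℕ}
    (hφ : ∀ v ∈ l, ∀ x y, v.Links x y → strandOf l' (φ x) = strandOf l' (φ y)) {x y : ℕ}
    (h : strandOf l x = strandOf l y) : strandOf l' (φ x) = strandOf l' (φ y) :=
  congrArg (Quot.lift (fun z => strandOf l' (φ z)) fun x y ⟨v, hv, hxy⟩ => hφ v hv x y hxy) h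

theorem strandOf_eq {l : List DiagramNode} {v : DiagramNode} (hv : v ∈ l) {x y : ℕ}
    (h : v.Links x y) : strandOf l x = strandOf l y := Quot.sound ⟨v, hv, h⟩

namespace Ranked

variable {l l' : List DiagramNode} {h h' : ℕ → ℕ} {H k : ℕ}

theorem eq_of_strandOf_eq (hr : Ranked l h H k) {x y : ℕ} (hxy : strandOf l x = strandOf l y) :
    h x = h y :=
  congrArg (Quot.lift h fun x y ⟨v, hv, hxy⟩ => hr.coherent v hv x y hxy) hxy

/-- Transport of levels to another diagram. -/
theorem transport (hr : Ranked l h H k) (φ : ℕ → ℕ)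
    (hφ : ∀ v ∈ l, ∀ x y, v.Links x y → strandOf l' (φ x) = strandOf l' (φ y))
    (coherent : ∀ v ∈ l', ∀ x y, v.Links x y → h' x = h' y)
    (over_le : ∀ v ∈ l', ∀ x, v.HasOver x → h' x ≤ H)
    (parent : ∀ v ∈ l, ∀ o u u', v.HasOver o → v.HasUnder u u' → h o < h u → h u' < h u →
      h u ≤ H → ∃ v ∈ l', ∃ o' u'', v.HasOver o' ∧ v.HasUnder (φ u) u'' ∧ h' o' < h' (φ u) ∧
        h' u'' < h' (φ u))
    (lift : ∀ x ∈ edgeLabels l', h' x ≤ H → ∃ z ∈ edgeLabels l, h z = h' x ∧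
      strandOf l' x = strandOf l' (φ z)) : Ranked l' h' H k := by
  refine ⟨coherent, over_le, ?_, ?_⟩
  · intro x hx h0 hH
    obtain ⟨z, hz, hzx, hxz⟩ := lift x hx hH
    obtain ⟨v, hv, o, u, u', ho, hu, hou, huu, hzu⟩ := hr.parent z hz (hzx ▸ h0) (hzx ▸ hH)
    obtain ⟨v', hv', o', u'', h1, h2, h3, h4⟩ :=
      parent v hv o u u' ho hu hou huu (by rw [← hr.eq_of_strandOf_eq hzu, hzx]; exact hH)
    exact ⟨v', hv', o', φ u, u'', h1, h2, h3, h4, hxz.trans (strandOf_eq_of_map hφ hzu)⟩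
  · obtain ⟨S, hS, hS'⟩ := hr.seeds
    refine ⟨S.image φ, Finset.card_image_le.trans hS, fun x hx h0 => ?_⟩
    obtain ⟨z, hz, hzx, hxz⟩ := lift x hx (h0 ▸ Nat.zero_le _)
    obtain ⟨s, hs, hzs⟩ := hS' z hz (hzx.trans h0)
    exact ⟨φ s, Finset.mem_image_of_mem _ hs, hxz.trans (strandOf_eq_of_map hφ hzs)⟩

theorem of_nodes (hr : Ranked l h H k)
    (h1 : ∀ v ∈ l, ∃ w ∈ l', (∀ x y, w.Links x y ↔ v.Links x y) ∧
      (∀ x, w.HasOver x ↔ v.HasOver x) ∧ (∀ x y, w.HasUnder x y ↔ v.HasUnder x y))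
    (h2 : ∀ w ∈ l', ∃ v ∈ l, (∀ x y, w.Links x y ↔ v.Links x y) ∧
      (∀ x, w.HasOver x ↔ v.HasOver x) ∧ (∀ x, x ∈ w.labels ↔ x ∈ v.labels)) :
    Ranked l' h H k := by
  refine hr.transport id ?_ ?_ ?_ ?_ ?_
  · intro v hv x y hxy
    obtain ⟨w, hw, h3, -⟩ := h1 v hv
    exact strandOf_eq hw ((h3 x y).2 hxy)
  · intro w hw x y hxy
    obtain ⟨v, hv, h3, -⟩ := h2 w hw
    exact hr.coherent v hv x y ((h3 x y).1 hxy)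
  · intro w hw x hx
    obtain ⟨v, hv, -, h3, -⟩ := h2 w hw
    exact hr.over_le v hv x ((h3 x).1 hx)
  · intro v hv o u u' ho hu h3 h4 h5
    obtain ⟨w, hw, -, h6, h7⟩ := h1 v hv
    exact ⟨w, hw, o, u', (h6 o).2 ho, (h7 u u').2 hu, h3, h4⟩
  · intro x hx _
    obtain ⟨w, hw, hxw⟩ := mem_edgeLabels.1 hx
    obtain ⟨v, hv, -, -, h3⟩ := h2 w hw
    exact ⟨x, mem_edgeLabels.2 ⟨v, hv, (h3 x).1 hxw⟩, rfl, rfl⟩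

theorem perm (hr : Ranked l h H k) (hl : l.Perm l') : Ranked l' h H k :=
  hr.of_nodes (fun v hv => ⟨v, hl.mem_iff.1 hv, by simp⟩)
    fun v hv => ⟨v, hl.mem_iff.2 hv, by simp⟩

theorem rotate {v : DiagramNode} (hr : Ranked (v :: l) h H k) : Ranked (v.rotate :: l) h H k := by
  refine hr.of_nodes ?_ ?_ <;> intro w hw <;> rcases List.mem_cons.1 hw with rfl | hw
  · exact ⟨_, List.mem_cons_self, fun _ _ => DiagramNode.links_rotate,
      fun _ => DiagramNode.hasOver_rotate, fun _ _ => DiagramNode.hasUnder_rotate⟩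
  · exact ⟨w, List.mem_cons_of_mem _ hw, by simp⟩
  · exact ⟨_, List.mem_cons_self, fun _ _ => DiagramNode.links_rotate,
      fun _ => DiagramNode.hasOver_rotate, fun _ => DiagramNode.mem_labels_rotate⟩
  · exact ⟨w, List.mem_cons_of_mem _ hw, by simp⟩

end Ranked

/-! ### Presentations with levels and weight -/

/-- The total weight of the edges of level `H`. -/
def levelWeight (l : List DiagramNode) (h : ℕ → ℕ) (H : ℕ) : ℕ :=
  (l.map (DiagramNode.weight fun x => if h x = H then 1 else 0)).sum

/-- The list presents a diagram of `K` with suitable levels. -/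
structure WeldedKnot.PresentsRanked (K : WeldedKnot) (l : List DiagramNode) (h : ℕ → ℕ)
    (H k w : ℕ) : Prop where
  presents : K.Presents l
  ranked : Ranked l h H k
  weight_eq : levelWeight l h H = w

namespace WeldedKnot.PresentsRanked

variable {K : WeldedKnot} {l l' : List DiagramNode} {h : ℕ → ℕ} {H k w : ℕ} {v v' : DiagramNode}

theorem perm (hK : K.PresentsRanked l h H k w) (hl : l.Perm l') :
    K.PresentsRanked l' h H k w :=
  ⟨hK.presents.perm hl, hK.ranked.perm hl, by
    rw [← hK.weight_eq]; exact (hl.map _).sum_eq.symm⟩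

theorem rotate (hK : K.PresentsRanked (v :: l) h H k w) :
    K.PresentsRanked (v.rotate :: l) h H k w :=
  ⟨hK.presents.rotate, hK.ranked.rotate, by
    rw [← hK.weight_eq]; simp [levelWeight, DiagramNode.weight_rotate]⟩

theorem rotate_iterate (t : ℕ) (hK : K.PresentsRanked (v :: l) h H k w) :
    K.PresentsRanked (DiagramNode.rotate^[t] v :: l) h H k w := by
  induction t with
  | zero => exact hK
  | succ t ih => rw [Function.iterate_succ_apply']; exact ih.rotate

theorem rotate_iterate_second (t : ℕ) (hK : K.PresentsRanked (v :: v' :: l) h H k w) :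
    K.PresentsRanked (v :: DiagramNode.rotate^[t] v' :: l) h H k w :=
  ((hK.perm (.swap _ _ _)).rotate_iterate t).perm (.swap _ _ _)

end WeldedKnot.PresentsRanked

/-! ### The two ends of an edge -/

namespace WeldedKnot.Presents

variable {K : WeldedKnot} {l : List DiagramNode} {v : DiagramNode}

theorem eq_or_eq_of_label_eq (hK : K.Presents l) {d e e' : Dart l} (h : d.label = e.label)
    (h' : d.label = e'.label) : d = e ∨ d = e' ∨ e = e' := by
  by_contra hne
  simp only [not_or] at hne
  obtain ⟨x, hx, hu⟩ := hK.isPlaneCurve.edge_ends d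
  exact hne.2.2 ((hu e ⟨hne.1, h⟩).trans (hu e' ⟨hne.2.1, h'⟩).symm)

/-- The other end of an edge is at another node. -/
theorem mem_edgeLabels_of_not_mem {k : CrossingKind} {o₁ i o₂ p : ℕ}
    (hK : K.Presents (.crossing k o₁ i o₂ p :: l)) (hp : p ∉ [o₁, i, o₂]) : p ∈ edgeLabels l := by
  set v := DiagramNode.crossing k o₁ i o₂ p
  obtain ⟨x, ⟨hne, hx⟩, -⟩ := hK.isPlaneCurve.edge_ends (Dart.head v l (3 : Fin 4))
  obtain ⟨q | x, rfl⟩ := (Dart.bijective_cons v l).surjective x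
  · exfalso
    change p = (![o₁, i, o₂, p] : Fin 4 → ℕ) q at hx
    simp only [List.mem_cons, List.not_mem_nil, or_false, not_or] at hp
    have hq : ∀ q : Fin 4, p = (![o₁, i, o₂, p] : Fin 4 → ℕ) q → q = 3 := by
      simp [Fin.forall_fin_succ, hp]
    rw [hq q hx] at hne
    exact hne rfl
  · exact Dart.mem_edgeLabels.2 ⟨x, hx.symm⟩

/-- An edge has only two ends. One is at `v` and one at slot `q` of `v'`, so there is no room for a
third. -/
theorem label_unique {v' : DiagramNode} (hK : K.Presents (v :: v' :: l)) {p : ℕ}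
    (hp : p ∈ v.labels) {q : Fin v'.arity} (hq : v'.label q = p) :
    (∀ q', v'.label q' = p → q' = q) ∧ p ∉ edgeLabels l := by
  obtain ⟨r, hr⟩ := DiagramNode.mem_labels.1 hp
  have hinj := (Dart.bijective_cons v (v' :: l)).injective
  have hinj' := (Dart.bijective_cons v' l).injective
  constructor
  · intro q' hq'
    rcases hK.eq_or_eq_of_label_eq (d := Dart.head v _ r) (e := Dart.tail v (Dart.head v' l q'))
      (e' := Dart.tail v (Dart.head v' l q)) (hr.trans hq'.symm) (hr.trans hq.symm) with h | h | h
    · cases @hinj (.inl _) (.inr _) h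
    · cases @hinj (.inl _) (.inr _) h
    · have := @hinj (.inr _) (.inr _) h
      exact Sum.inl.inj (@hinj' (.inl _) (.inl _) (Sum.inr.inj this))
  · intro hl
    obtain ⟨x, hx⟩ := Dart.mem_edgeLabels.1 hl
    rcases hK.eq_or_eq_of_label_eq (d := Dart.head v _ r) (e := Dart.tail v (Dart.tail v' x))
      (e' := Dart.tail v (Dart.head v' l q)) (hr.trans hx.symm) (hr.trans hq.symm) with h | h | h
    · cases @hinj (.inl _) (.inr _) h
    · cases @hinj (.inl _) (.inr _) h
    · have := @hinj (.inr _) (.inr _) h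
      cases @hinj' (.inr _) (.inl _) (Sum.inr.inj this)

theorem not_mem_of_point {y p : ℕ} (hK : K.Presents (v :: .point y p :: l)) (hp : p ∈ v.labels) :
    p ≠ y ∧ p ∉ edgeLabels l := by
  obtain ⟨h1, h2⟩ := hK.label_unique hp (q := (1 : Fin 2)) rfl
  refine ⟨?_, h2⟩
  rintro rfl
  have := congrArg Fin.val (h1 (0 : Fin 2) rfl)
  simp at this

theorem not_mem_of_crossing {k : CrossingKind} {w₁ w₂ y p : ℕ}
    (hK : K.Presents (v :: .crossing k w₁ p w₂ y :: l)) (hp : p ∈ v.labels) :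
    p ∉ [w₁, w₂, y] ∧ p ∉ edgeLabels l := by
  obtain ⟨h1, h2⟩ := hK.label_unique hp (q := (1 : Fin 4)) rfl
  refine ⟨?_, h2⟩
  simp only [List.mem_cons, List.not_mem_nil, or_false, not_or]
  refine ⟨?_, ?_, ?_⟩ <;> rintro rfl
  · have := congrArg Fin.val (h1 (0 : Fin 4) rfl); simp at this
  · have := congrArg Fin.val (h1 (2 : Fin 4) rfl); simp at this
  · have := congrArg Fin.val (h1 (3 : Fin 4) rfl); simp at this

/-- Merging a point with the adjacent crossing. -/
theorem merge {k : CrossingKind} {o₁ i o₂ p y : ℕ}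
    (hK : K.Presents (.crossing k o₁ i o₂ p :: .point y p :: l)) (hp : p ∉ [y, o₁, i, o₂])
    (hl : p ∉ edgeLabels l) : K.Presents (.crossing k o₁ i o₂ y :: l) := by
  have h := hK.rotate.rotate.rotate.perm (.swap _ _ _)
  have h2 := ((Presents.subdivide_iff hp hl).2 h).rotate
  cases k <;> exact h2

end WeldedKnot.Presents

/-! ### Levels and weight when a strand is shortened or pushed -/

namespace Ranked

variable {l : List DiagramNode} {h : ℕ → ℕ} {H k : ℕ}

theorem merge {o₁ i o₂ p y : ℕ}
    (hr : Ranked (.crossing .firstOver o₁ i o₂ p :: .point y p :: l) h H k)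
    (hp : p ∉ [y, o₁, i, o₂]) (hl : p ∉ edgeLabels l) :
    Ranked (.crossing .firstOver o₁ i o₂ y :: l) h H k := by
  have hpy : h y = h p := hr.coherent (.point y p) (by simp) _ _ (by simp [DiagramNode.Links])
  simp only [List.mem_cons, List.not_mem_nil, or_false, not_or] at hp
  obtain ⟨hpy', hp1, hp2, hp3⟩ := hp
  have hlab : ∀ v ∈ l, p ∉ v.labels := fun v hv hp => hl (mem_edgeLabels.2 ⟨v, hv, hp⟩)
  have hφ : ∀ x, x ≠ p → (if x = p then y else x) = x := fun x hx => if_neg hx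
  -- The edge `p` is absorbed into `y`.
  refine hr.transport (fun x => if x = p then y else x) ?_ ?_ ?_ ?_ ?_
  · intro v hv a b hab
    simp only [List.mem_cons] at hv
    rcases hv with rfl | rfl | hv
    · refine strandOf_eq (List.mem_cons_self) ?_
      simp only [DiagramNode.Links] at hab ⊢
      rcases hab with ⟨rfl, rfl⟩ | ⟨rfl, rfl⟩ <;> simp [Ne.symm hp1, Ne.symm hp3]
    · simp only [DiagramNode.Links] at hab
      rcases hab with ⟨rfl, rfl⟩ | ⟨rfl, rfl⟩ <;> simp
    · obtain ⟨ha, hb⟩ := hab.mem_labels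
      have ha' : a ≠ p := fun h => hlab v hv (h ▸ ha)
      have hb' : b ≠ p := fun h => hlab v hv (h ▸ hb)
      simp only [hφ a ha', hφ b hb']
      exact strandOf_eq (List.mem_cons_of_mem _ hv) hab
  · intro v hv a b hab
    rcases List.mem_cons.1 hv with rfl | hv
    · exact hr.coherent (.crossing .firstOver o₁ i o₂ p) (by simp) a b hab
    · exact hr.coherent v (by simp [hv]) a b hab
  · intro v hv a ha
    rcases List.mem_cons.1 hv with rfl | hv
    · exact hr.over_le (.crossing .firstOver o₁ i o₂ p) (by simp) a ha
    · exact hr.over_le v (by simp [hv]) a ha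
  · intro v hv o u u' ho hu h1 h2 _
    simp only [List.mem_cons] at hv
    rcases hv with rfl | rfl | hv
    · refine ⟨_, List.mem_cons_self, o, if u' = p then y else u', ho, ?_, ?_, ?_⟩
      · simp only [DiagramNode.HasUnder] at hu ⊢
        rcases hu with ⟨rfl, rfl⟩ | ⟨rfl, rfl⟩ <;> simp [Ne.symm hp2]
      · split_ifs with hu'
        · rw [hpy, ← hu']; exact h1
        · exact h1
      · split_ifs <;> simp_all
    · exact absurd ho (by simp [DiagramNode.HasOver])
    · obtain ⟨hu1, hu2⟩ := hu.mem_labels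
      have hu' : u ≠ p := fun h => hlab v hv (h ▸ hu1)
      refine ⟨v, List.mem_cons_of_mem _ hv, o, u', ho, ?_⟩
      simp only [hφ u hu']
      exact ⟨hu, h1, h2⟩
  · intro x hx _
    have hxp : x ≠ p := by
      rintro rfl
      rw [edgeLabels_cons, List.mem_append] at hx
      rcases hx with hx | hx
      · simp [DiagramNode.labels] at hx; tauto
      · exact hl hx
    refine ⟨x, ?_, rfl, by simp only [hφ x hxp]⟩
    simp only [edgeLabels_cons, DiagramNode.labels, List.mem_append, List.mem_cons,
      List.not_mem_nil, or_false] at hx ⊢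
    tauto

/-- The level of the arcs between the new crossings of a strand that has been pushed across a
crossing; `m` is the old level of this strand. -/
def shortLevel (q : CrossingKind) (m H : ℕ) : ℕ :=
  match q with
  | .virt => m
  | _ => H + 1

/-- The levels after a strand has been pushed across a crossing. -/
def pushLevel (h : ℕ → ℕ) (H : ℕ) (q : CrossingKind) (o₁ i w₁ p a b e f : ℕ) (x : ℕ) : ℕ :=
  if x = p then h i else if x = a ∨ x = e then h o₁ else if x = b ∨ x = f then
    shortLevel q (h w₁) H else h x

section

variable {q : CrossingKind} {o₁ i o₂ p w₁ w₂ y a b e f : ℕ} {h' : ℕ → ℕ}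

/-- If `w` passes under `p`, the two over-ends of level `H` vanish and none arises. If the crossing
is virtual, let `τ` be `1` or `0` according to whether `w` has level `H`: the old weight is `2τ + 2
+ 4τ`, and each of the three new virtual crossings weighs `2τ`, so `6τ + 2` drops to `6τ`. The
product in `weight` is what pays for the two additional crossings when `w` has level `H` itself. -/
theorem weight_push (hq : q ≠ .firstOver)
    (hl : ∀ x ∈ edgeLabels l, h' x = h x) (hold : ∀ x ∈ [y, w₁, o₁, i, o₂, w₂], h' x = h x)
    (gp : h' p = h i) (ga : h' a = h o₁) (ge : h' e = h o₁)
    (gb : h' b = shortLevel q (h w₁) H) (gf : h' f = shortLevel q (h w₁) H)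
    (hpH : h p = H) (hi : h i < H) (ho : h o₁ < H)
    (hr : Ranked (.crossing .firstOver o₁ i o₂ p :: .crossing q w₁ p w₂ y :: l) h H k) :
    levelWeight (.crossing q.swap a b o₂ w₂ :: .crossing .firstOver e p a y ::
      .crossing q f i b p :: .crossing q f e w₁ o₁ :: l) h' H <
      levelWeight (.crossing .firstOver o₁ i o₂ p :: .crossing q w₁ p w₂ y :: l) h H := by
  have ho₂ : h o₂ = h o₁ := hr.coherent (.crossing .firstOver o₁ i o₂ p) (by simp) _ _
    (by simp [DiagramNode.Links])
  have hy : h y = H := by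
    rw [← hpH]
    refine hr.coherent (.crossing q w₁ p w₂ y) (by simp) _ _ ?_
    cases q <;> simp [DiagramNode.Links] at hq ⊢
  have hw : q = .virt → h w₂ = h w₁ := fun hq => by
    subst hq
    exact hr.coherent (.crossing .virt w₁ p w₂ y) (by simp) _ _ (by simp [DiagramNode.Links])
  have gw₁ := hold w₁ (by simp)
  have go₁ := hold o₁ (by simp)
  have gi := hold i (by simp)
  have go₂ := hold o₂ (by simp)
  have gw₂ := hold w₂ (by simp)
  have hlw : (l.map (DiagramNode.weight fun x => if h' x = H then 1 else 0)) =
      l.map (DiagramNode.weight fun x => if h x = H then 1 else 0) := by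
    refine List.map_congr_left fun v hv => ?_
    have : ∀ x ∈ v.labels, h' x = h x := fun x hx => hl x (mem_edgeLabels.2 ⟨v, hv, hx⟩)
    rcases v with ⟨a, b⟩ | ⟨_ | _ | _, a, b, c, d⟩ <;>
      simp only [DiagramNode.labels, List.mem_cons, List.not_mem_nil, or_false, forall_eq_or_imp,
        forall_eq] at this <;> simp only [DiagramNode.weight, this]
  have hio : ¬ h i = H := by omega
  have hoo : ¬ h o₁ = H := by omega
  simp only [levelWeight, List.map_cons, List.sum_cons, hlw]
  cases q with
  | firstOver => exact absurd rfl hq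
  | secondOver =>
    simp only [DiagramNode.weight, CrossingKind.swap, ga, go₂, ge, gi, gp, go₁, ho₂, hy, hpH,
      if_neg hio, if_neg hoo, if_true]
    omega
  | virt =>
    simp only [DiagramNode.weight, CrossingKind.swap, shortLevel, ga, go₂, ge, gi, gp, go₁, gw₁,
      gw₂, gb, gf, ho₂, hy, hpH, if_neg hio, if_neg hoo, if_true, hw rfl]
    omega

/-- The strand that began with `p` now begins with `y`, at a crossing with the same overstrand,
while the label `p` is reused for the continuation of the understrand `i`. If `w` was under, its new
arcs `b` and `f` have undercrossings at both ends; the level `H + 1` frees them from the conditions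
on parents and seeds. -/
theorem push (hq : q ≠ .firstOver) (hp : p ∉ [y, w₁, o₁, i, o₂, w₂]) (hpl : p ∉ edgeLabels l)
    (hll : ∀ x ∈ edgeLabels l, h' x = h x) (hout' : ∀ x ∈ [y, w₁, o₁, i, o₂, w₂], h' x = h x)
    (gp : h' p = h i) (ga : h' a = h o₁) (ge : h' e = h o₁)
    (gb : h' b = shortLevel q (h w₁) H) (gf : h' f = shortLevel q (h w₁) H)
    (hpH : h p = H) (hi : h i < H) (ho : h o₁ < H)
    (hr : Ranked (.crossing .firstOver o₁ i o₂ p :: .crossing q w₁ p w₂ y :: l) h H k) :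
    Ranked (.crossing q.swap a b o₂ w₂ :: .crossing .firstOver e p a y ::
      .crossing q f i b p :: .crossing q f e w₁ o₁ :: l) h' H k := by
  set l' : List DiagramNode := .crossing q.swap a b o₂ w₂ :: .crossing .firstOver e p a y ::
      .crossing q f i b p :: .crossing q f e w₁ o₁ :: l with hl'
  have ho₂ : h o₂ = h o₁ := hr.coherent (.crossing .firstOver o₁ i o₂ p) (by simp) _ _
    (by simp [DiagramNode.Links])
  have hy : h y = H := by
    rw [← hpH]
    refine hr.coherent (.crossing q w₁ p w₂ y) (by simp) _ _ ?_
    cases q <;> simp [DiagramNode.Links] at hq ⊢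
  have hpo := hp
  simp only [List.mem_cons, List.not_mem_nil, or_false, not_or] at hpo
  obtain ⟨hpy, hpw₁, hpo₁, hpi, hpo₂, hpw₂⟩ := hpo
  have gy := hout' y (by simp)
  have gw₁ := hout' w₁ (by simp)
  have go₁ := hout' o₁ (by simp)
  have gi := hout' i (by simp)
  have go₂ := hout' o₂ (by simp)
  have gw₂ := hout' w₂ (by simp)
  have hlab : ∀ v ∈ l, p ∉ v.labels := fun v hv hp => hpl (mem_edgeLabels.2 ⟨v, hv, hp⟩)
  have hlab' : ∀ v ∈ l, ∀ x ∈ v.labels, h' x = h x :=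
    fun v hv x hx => hll x (mem_edgeLabels.2 ⟨v, hv, hx⟩)
  have hφ : ∀ x, x ≠ p → (if x = p then y else x) = x := fun x hx => if_neg hx
  have hsub : ∀ v ∈ l, v ∈ l' := fun v hv => by simp [hl', hv]
  have hw : q = .virt → h w₂ = h w₁ := fun hq => by
    subst hq
    exact hr.coherent (.crossing .virt w₁ p w₂ y) (by simp) _ _ (by simp [DiagramNode.Links])
  have sea : strandOf l' e = strandOf l' a := strandOf_eq
    (v := .crossing .firstOver e p a y) (by simp [hl']) (by simp [DiagramNode.Links])
  have seo : strandOf l' e = strandOf l' o₁ := strandOf_eq (v := .crossing q f e w₁ o₁)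
    (by simp [hl']) (by cases q <;> simp [DiagramNode.Links] at hq ⊢)
  have sao : strandOf l' a = strandOf l' o₂ := strandOf_eq (v := .crossing q.swap a b o₂ w₂)
    (by simp [hl']) (by cases q <;> simp [DiagramNode.Links, CrossingKind.swap] at hq ⊢)
  have spi : strandOf l' p = strandOf l' i := strandOf_eq (v := .crossing q f i b p)
    (by simp [hl']) (by cases q <;> simp [DiagramNode.Links] at hq ⊢)
  have sfw : q = .virt → strandOf l' f = strandOf l' w₁ := by
    rintro rfl
    exact strandOf_eq (v := .crossing .virt f e w₁ o₁) (by simp [hl']) (by simp [DiagramNode.Links])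
  have sfb : q = .virt → strandOf l' f = strandOf l' b := by
    rintro rfl
    exact strandOf_eq (v := .crossing .virt f i b p) (by simp [hl']) (by simp [DiagramNode.Links])
  have sbw : q = .virt → strandOf l' b = strandOf l' w₂ := by
    rintro rfl
    exact strandOf_eq (v := .crossing .virt a b o₂ w₂) (by simp [hl', CrossingKind.swap])
      (by simp [DiagramNode.Links])
  -- The old edge `p` corresponds to `y`, its successor on the strand, because `p` now lies on the
  -- strand of `i`.
  refine hr.transport (fun x => if x = p then y else x) ?_ ?_ ?_ ?_ ?_
  · intro v hv x z hxz
    simp only [List.mem_cons] at hv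
    rcases hv with rfl | rfl | hv
    · have key := (seo.symm.trans sea).trans sao
      simp only [DiagramNode.Links] at hxz
      rcases hxz with ⟨rfl, rfl⟩ | ⟨rfl, rfl⟩ <;>
        simp only [hφ _ (Ne.symm hpo₁), hφ _ (Ne.symm hpo₂), key]
    · cases q with
      | firstOver => exact absurd rfl hq
      | secondOver =>
        simp only [DiagramNode.Links] at hxz
        rcases hxz with ⟨rfl, rfl⟩ | ⟨rfl, rfl⟩ <;> simp
      | virt =>
        have key := ((sfw rfl).symm.trans (sfb rfl)).trans (sbw rfl)
        simp only [DiagramNode.Links] at hxz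
        rcases hxz with (⟨rfl, rfl⟩ | ⟨rfl, rfl⟩) | ⟨rfl, rfl⟩ | ⟨rfl, rfl⟩
        · simp only [hφ _ (Ne.symm hpw₁), hφ _ (Ne.symm hpw₂), key]
        · simp only [hφ _ (Ne.symm hpw₁), hφ _ (Ne.symm hpw₂), key]
        · simp
        · simp
    · obtain ⟨hx, hz⟩ := hxz.mem_labels
      have hx' : x ≠ p := fun h => hlab v hv (h ▸ hx)
      have hz' : z ≠ p := fun h => hlab v hv (h ▸ hz)
      simp only [hφ x hx', hφ z hz']
      exact strandOf_eq (hsub v hv) hxz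
  · intro v hv x z hxz
    simp only [hl', List.mem_cons] at hv
    rcases hv with rfl | rfl | rfl | rfl | hv
    rotate_right
    · rw [hlab' v hv x hxz.mem_labels.1, hlab' v hv z hxz.mem_labels.2]
      exact hr.coherent v (by simp [hv]) x z hxz
    all_goals
      clear hr hl' hll hout' hlab hlab' hφ hsub
      cases q <;> simp only [DiagramNode.Links, CrossingKind.swap, shortLevel] at hxz hq gb gf <;>
        grind
  · intro v hv x hx
    simp only [hl', List.mem_cons] at hv
    rcases hv with rfl | rfl | rfl | rfl | hv
    rotate_right
    · rw [hlab' v hv x hx.mem_labels]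
      exact hr.over_le v (by simp [hv]) x hx
    all_goals
      clear hr hl' hll hout' hlab hlab' hφ hsub
      cases q <;> simp only [DiagramNode.HasOver, CrossingKind.swap] at hx hq <;> grind
  · intro v hv o u u' ho' hu h1 h2 h3
    simp only [List.mem_cons] at hv
    rcases hv with rfl | rfl | hv
    · simp only [DiagramNode.HasUnder] at hu
      rcases hu with ⟨rfl, rfl⟩ | ⟨rfl, rfl⟩
      · omega
      -- The new beginning of the strand: `y` emerges under the overstrand `e`, `a`, opposite to the
      -- edge that continues `i`.
      · refine ⟨.crossing .firstOver e u a y, by simp [hl'], e, u, by simp [DiagramNode.HasOver],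
          by simp [DiagramNode.HasUnder], ?_, ?_⟩ <;> simp only [if_true] <;> omega
    · cases q with
      | firstOver => exact absurd rfl hq
      -- This crossing was nobody's beginning: its overstrand has level `H`, whereas a parent must
      -- lie strictly below a level that is at most `H`.
      | secondOver =>
        simp only [DiagramNode.HasOver] at ho'
        rcases ho' with rfl | rfl <;> omega
      | virt => exact absurd ho' (by simp [DiagramNode.HasOver])
    · obtain ⟨hu1, hu2⟩ := hu.mem_labels
      have hu' : u ≠ p := fun h => hlab v hv (h ▸ hu1)
      refine ⟨v, hsub v hv, o, u', ho', ?_⟩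
      simp only [hφ u hu']
      rw [hlab' v hv u hu1, hlab' v hv u' hu2, hlab' v hv o ho'.mem_labels]
      exact ⟨hu, h1, h2⟩
  · intro x hx hxH
    by_cases hxl : x ∈ edgeLabels l
    · refine ⟨x, ?_, (hll x hxl).symm, by rw [hφ x fun h => hpl (h ▸ hxl)]⟩
      simp only [edgeLabels_cons, List.mem_append]
      exact .inr (.inr hxl)
    suffices hs : ∃ z ∈ [y, w₁, o₁, i, o₂, w₂], h z = h' x ∧ strandOf l' x = strandOf l' z by
      obtain ⟨z, hz, hzx, hxz⟩ := hs
      refine ⟨z, ?_, hzx, by rw [hφ z fun h => hp (h ▸ hz), hxz]⟩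
      simp only [List.mem_cons, List.not_mem_nil, or_false] at hz
      rcases hz with rfl | rfl | rfl | rfl | rfl | rfl <;>
        simp [edgeLabels_cons, DiagramNode.labels]
    by_cases hxo : x ∈ [y, w₁, o₁, i, o₂, w₂]
    · exact ⟨x, hxo, (hout' x hxo).symm, rfl⟩
    have hx5 : x = p ∨ x = a ∨ x = e ∨ x = b ∨ x = f := by
      by_contra hcon
      simp only [List.mem_cons, List.not_mem_nil, or_false, not_or] at hxo hcon
      simp [hl', edgeLabels_cons, DiagramNode.labels, hxl, hxo, hcon] at hx
    -- At a classical crossing the arcs `b` and `f` have level `H + 1`, which `hxH` excludes.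
    have hbf : x = b ∨ x = f → q = .virt := by
      intro hxbf
      cases q with
      | firstOver => exact absurd rfl hq
      | virt => rfl
      | secondOver => rcases hxbf with rfl | rfl <;> simp only [shortLevel] at gb gf <;> omega
    rcases hx5 with rfl | rfl | rfl | hx5 | hx5
    · exact ⟨i, by simp, gp.symm, spi⟩
    · exact ⟨o₁, by simp, ga.symm, sea.symm.trans seo⟩
    · exact ⟨o₁, by simp, ge.symm, seo⟩
    · have hv := hbf (.inl hx5)
      rw [hx5]
      exact ⟨w₁, by simp, by rw [gb, hv]; rfl, (sfb hv).symm.trans (sfw hv)⟩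
    · have hv := hbf (.inr hx5)
      rw [hx5]
      exact ⟨w₁, by simp, by rw [gf, hv]; rfl, sfw hv⟩

end

end Ranked

/-! ### Descent to level zero -/

namespace DiagramNode

theorem links_rotate_iterate {v : DiagramNode} {x y : ℕ} (t : ℕ) :
    (rotate^[t] v).Links x y ↔ v.Links x y := by
  induction t with
  | zero => rfl
  | succ t ih => rw [Function.iterate_succ_apply', links_rotate, ih]

theorem Links.symm {v : DiagramNode} {x y : ℕ} (h : v.Links x y) : v.Links y x := by
  rcases v with _ | ⟨_ | _ | _, _, _, _, _⟩ <;> simp only [Links] at h ⊢ <;> tauto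

theorem HasOver.exists_links {v : DiagramNode} {x : ℕ} (h : v.HasOver x) : ∃ y, v.Links x y := by
  rcases v with _ | ⟨_ | _ | _, a, b, c, d⟩ <;> simp only [HasOver] at h <;> simp only [Links]
  · rcases h with rfl | rfl
    · exact ⟨c, .inl ⟨rfl, rfl⟩⟩
    · exact ⟨a, .inr ⟨rfl, rfl⟩⟩
  · rcases h with rfl | rfl
    · exact ⟨d, .inl ⟨rfl, rfl⟩⟩
    · exact ⟨b, .inr ⟨rfl, rfl⟩⟩

end DiagramNode

theorem List.exists_perm_cons_of_mem {α : Type*} {a : α} {l : List α} (h : a ∈ l) :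
    ∃ l', l.Perm (a :: l') := by
  obtain ⟨s, t, rfl⟩ := List.append_of_mem h
  exact ⟨s ++ t, List.perm_middle⟩

/-- An edge on a strand with an overcrossing is not under at both of its ends. -/
theorem exists_links_of_strandOf_eq {l : List DiagramNode} {v : DiagramNode} {x u : ℕ}
    (hv : v ∈ l) (hx : v.HasOver x) (h : strandOf l x = strandOf l u) :
    ∃ w ∈ l, ∃ z, w.Links u z := by
  by_contra hne
  push Not at hne
  -- If nothing is linked to `u`, the class of `u` is the single edge `u`, so being equal to `u` is
  -- well defined on strands.
  have key : (x = u) = (u = u) := congrArg (Quot.lift (fun z => z = u) (by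
    rintro a b ⟨w, hw, hab⟩
    refine propext ⟨?_, ?_⟩ <;> rintro rfl
    · exact absurd hab (hne w hw b)
    · exact absurd hab.symm (hne w hw a))) h
  have hxu : x = u := by rw [key]
  obtain ⟨z, hz⟩ := hx.exists_links
  exact hne v hv z (hxu ▸ hz)

namespace WeldedKnot.PresentsRanked

variable {K : WeldedKnot} {l : List DiagramNode} {h : ℕ → ℕ} {H k w : ℕ}

/-- A crossing of a strand of level `H` can be pushed off the beginning of the strand. -/
theorem exists_lt (hK : K.PresentsRanked l h H k w) (hH : 0 < H) {v : DiagramNode} {x : ℕ}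
    (hv : v ∈ l) (hx : v.HasOver x) (hxH : h x = H) :
    ∃ l' h' w', w' < w ∧ K.PresentsRanked l' h' H k w' := by
  obtain ⟨C, hC, o, p, i, ho, hp, hop, hip, hxp⟩ := hK.ranked.parent x
    (mem_edgeLabels.2 ⟨v, hv, hx.mem_labels⟩) (hxH ▸ hH) hxH.le
  have hpH : h p = H := by rw [← hK.ranked.eq_of_strandOf_eq hxp, hxH]
  -- The strand of `p` contains an overcrossing, so `p` continues straight at some vertex; this
  -- later rules out that `p` is under at its far end too.
  obtain ⟨u, hu, z, huz⟩ := exists_links_of_strandOf_eq hv hx hxp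
  obtain ⟨l₁, hl₁⟩ := List.exists_perm_cons_of_mem hC
  obtain ⟨t, o₁, o₂, hrot, ho⟩ := DiagramNode.exists_rotate_eq_crossing ho hp
  have hK₁ := (hK.perm hl₁).rotate_iterate t
  rw [hrot] at hK₁
  have ho₁₂ : h o₁ = h o₂ := hK₁.ranked.coherent _ List.mem_cons_self _ _
    (by simp [DiagramNode.Links])
  have ho₁ : h o₁ < H := by rcases ho with rfl | rfl <;> omega
  -- The levels tell `p` apart from the other edges at its first crossing, so its far end is at
  -- another vertex.
  have hp3 : p ≠ o₁ ∧ p ≠ i ∧ p ≠ o₂ := by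
    refine ⟨?_, ?_, ?_⟩ <;> rintro rfl <;> omega
  obtain ⟨V, hV, hpV⟩ := mem_edgeLabels.1
    (hK₁.presents.mem_edgeLabels_of_not_mem (by simp; tauto))
  obtain ⟨l₂, hl₂⟩ := List.exists_perm_cons_of_mem hV
  have hmem := (hl₁.trans (hl₂.cons C)).mem_iff.1 hu
  rcases DiagramNode.exists_rotate_eq hpV with ⟨s, y, hs⟩ | ⟨s, q, w₁, w₂, y, hs⟩
  -- A point next to the crossing is absorbed; the weight drops by its two ends of level `H`.
  · have hK₂ := (hK₁.perm (hl₂.cons _)).rotate_iterate_second s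
    rw [hs] at hK₂
    obtain ⟨hpy, hpl⟩ := hK₂.presents.not_mem_of_point (by simp [DiagramNode.labels])
    have hp4 : p ∉ [y, o₁, i, o₂] := by simp; tauto
    refine ⟨_, h, _, ?_, hK₂.presents.merge hp4 hpl, hK₂.ranked.merge hp4 hpl, rfl⟩
    rw [← hK₂.weight_eq]
    simp only [levelWeight, List.map_cons, List.sum_cons, DiagramNode.weight, hpH, if_true]
    omega
  · have hK₂ := (hK₁.perm (hl₂.cons _)).rotate_iterate_second s
    rw [hs] at hK₂
    obtain ⟨hpw, hpl⟩ := hK₂.presents.not_mem_of_crossing (by simp [DiagramNode.labels])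
    have hp6 : p ∉ [y, w₁, o₁, i, o₂, w₂] := by
      simp only [List.mem_cons, List.not_mem_nil, or_false, not_or] at hpw ⊢; tauto
    have hq : q ≠ .firstOver := by
      rintro rfl
      simp only [List.mem_cons] at hmem
      rcases hmem with rfl | rfl | hu2
      · rw [← DiagramNode.links_rotate_iterate t, hrot] at huz
        simp only [DiagramNode.Links] at huz
        tauto
      · rw [← DiagramNode.links_rotate_iterate s, hs] at huz
        simp only [DiagramNode.Links] at huz
        simp only [List.mem_cons, List.not_mem_nil, or_false, not_or] at hpw
        tauto
      · exact hpl (mem_edgeLabels.2 ⟨u, hu2, huz.mem_labels.1⟩)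
    -- The labels from `M` on are unused; `M`, …, `M + 3` become the new edges `a`, `b`, `e`, `f`.
    obtain ⟨M, hM⟩ : ∃ M, ∀ x ∈ p :: [y, w₁, o₁, i, o₂, w₂] ++ edgeLabels l₂, x < M := by
      refine ⟨(p :: [y, w₁, o₁, i, o₂, w₂] ++ edgeLabels l₂).sum + 1, fun x hx => ?_⟩
      exact Nat.lt_succ_of_le (List.le_sum_of_mem hx)
    have hMp := hM p (by simp)
    have hM6 : ∀ x ∈ [y, w₁, o₁, i, o₂, w₂], x < M := fun x hx => hM x (by
      rw [List.mem_append]; exact .inl (List.mem_cons_of_mem _ hx))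
    have hMl : ∀ x ∈ edgeLabels l₂, x < M := fun x hx => hM x (by
      rw [List.mem_append]; exact .inr hx)
    have hnew : [p, M, M + 1, M + 2, M + 3].Nodup := by simp; omega
    have hfive : ∀ x ∈ [p, M, M + 1, M + 2, M + 3], x = p ∨ M ≤ x := by simp
    have hout : ∀ x ∈ [p, M, M + 1, M + 2, M + 3], x ∉ [y, w₁, o₁, i, o₂, w₂] := by
      intro x hx hx6
      rcases hfive x hx with rfl | h
      · exact hp6 hx6
      · exact absurd (hM6 x hx6) (not_lt.2 h)
    have hl : ∀ x ∈ [p, M, M + 1, M + 2, M + 3], x ∉ edgeLabels l₂ := by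
      intro x hx hx6
      rcases hfive x hx with rfl | h
      · exact hpl hx6
      · exact absurd (hMl x hx6) (not_lt.2 h)
    let h' := Ranked.pushLevel h H q o₁ i w₁ p M (M + 1) (M + 2) (M + 3)
    have hold : ∀ x, x ≠ p → x < M → h' x = h x := by
      intro x hx hxM
      simp only [h', Ranked.pushLevel, if_neg hx]
      rw [if_neg (by omega), if_neg (by omega)]
    have hh6 : ∀ x ∈ [y, w₁, o₁, i, o₂, w₂], h' x = h x :=
      fun x hx => hold x (fun h => hp6 (h ▸ hx)) (hM6 x hx)
    have hhl : ∀ x ∈ edgeLabels l₂, h' x = h x :=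
      fun x hx => hold x (fun h => hpl (h ▸ hx)) (hMl x hx)
    have gp : h' p = h i := by simp [h', Ranked.pushLevel]
    have ga : h' M = h o₁ := by simp [h', Ranked.pushLevel, hMp.ne']
    have gb : h' (M + 1) = Ranked.shortLevel q (h w₁) H := by
      simp [h', Ranked.pushLevel, (show M + 1 ≠ p by omega)]
    have ge : h' (M + 2) = h o₁ := by
      simp [h', Ranked.pushLevel, (show M + 2 ≠ p by omega)]
    have gf : h' (M + 3) = Ranked.shortLevel q (h w₁) H := by
      simp [h', Ranked.pushLevel, (show M + 3 ≠ p by omega)]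
    refine ⟨_, h', _, ?_, hK₂.presents.push hq hnew hout hl, hK₂.ranked.push hq hp6 hpl hhl hh6
      gp ga ge gb gf hpH (hpH ▸ hip) ho₁, rfl⟩
    rw [← hK₂.weight_eq]
    exact hK₂.ranked.weight_push hq hhl hh6 gp ga ge gb gf hpH (hpH ▸ hip) ho₁

/-- All overcrossings can be moved to the seeds. -/
theorem exists_level_zero (hK : K.PresentsRanked l h H k w) :
    ∃ l' h', K.Presents l' ∧ Ranked l' h' 0 k := by
  induction H generalizing l h w with
  | zero => exact ⟨l, h, hK.presents, hK.ranked⟩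
  | succ H ihH =>
    induction w using Nat.strong_induction_on generalizing l h with
    | _ w ihw =>
      by_cases hx : ∃ v ∈ l, ∃ x, v.HasOver x ∧ h x = H + 1
      · obtain ⟨v, hv, x, hx, hxH⟩ := hx
        obtain ⟨l', h', w', hlt, hK'⟩ := hK.exists_lt H.succ_pos hv hx hxH
        exact ihw w' hlt hK'
      · push Not at hx
        -- No overcrossing has level `H + 1` any more. Strands of that level exceed the lowered
        -- bound, and nothing is required of where they begin.
        have hr : Ranked l h H k :=
          { coherent := hK.ranked.coherent
            over_le := fun v hv x hxv =>
              Nat.le_of_lt_succ ((hK.ranked.over_le v hv x hxv).lt_of_ne (hx v hv x hxv))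
            parent := fun x hx h0 hH => hK.ranked.parent x hx h0 (hH.trans H.le_succ)
            seeds := hK.ranked.seeds }
        exact ihH ⟨hK.presents, hr, rfl⟩

end WeldedKnot.PresentsRanked

/-! ### From edge labels back to slots and darts -/

namespace DiagramNode

/-- The opposite slot. -/
def oppSlot (v : DiagramNode) (p : Fin v.arity) : Fin v.arity := (finRotate _ ^ (v.arity / 2)) p

theorem oppSlot_crossing (k : CrossingKind) (a b c d : ℕ) (p : Fin 4) :
    (crossing k a b c d).oppSlot p = (p + 2 : Fin 4) := by
  have : ∀ p : Fin 4, (finRotate 4 ^ (4 / 2)) p = p + 2 := by decide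
  exact this p

theorem oppSlot_point (a b : ℕ) (p : Fin 2) : (point a b).oppSlot p = (p + 1 : Fin 2) := by
  have : ∀ p : Fin 2, (finRotate 2 ^ (2 / 2)) p = p + 1 := by decide
  exact this p

theorem oppSlot_oppSlot (v : DiagramNode) (p : Fin v.arity) : v.oppSlot (v.oppSlot p) = p := by
  cases v with
  | point a b =>
    have : ∀ p : Fin 2, p + 1 + 1 = p := by decide
    exact (congrArg _ (oppSlot_point a b p)).trans ((oppSlot_point a b _).trans (this p))
  | crossing k a b c d =>
    have : ∀ p : Fin 4, p + 2 + 2 = p := by decide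
    exact (congrArg _ (oppSlot_crossing k a b c d p)).trans
      ((oppSlot_crossing k a b c d _).trans (this p))

theorem isUnder_oppSlot (v : DiagramNode) (p : Fin v.arity) :
    v.IsUnder (v.oppSlot p) ↔ v.IsUnder p := by
  have key : ∀ p : Fin 4, (p + 2).val % 2 = p.val % 2 := by decide
  rcases v with _ | ⟨_ | _ | _, a, b, c, d⟩
  · exact Iff.rfl
  · change ((oppSlot _ p).val % 2 = 1) ↔ p.val % 2 = 1
    rw [← key p]
    exact Iff.of_eq (congrArg (fun q : Fin 4 => q.val % 2 = 1) (oppSlot_crossing _ a b c d p))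
  · change ((oppSlot _ p).val % 2 = 0) ↔ p.val % 2 = 0
    rw [← key p]
    exact Iff.of_eq (congrArg (fun q : Fin 4 => q.val % 2 = 0) (oppSlot_crossing _ a b c d p))
  · exact Iff.rfl

theorem IsOver.not_isUnder {v : DiagramNode} {p : Fin v.arity} (h : v.IsOver p) :
    ¬ v.IsUnder p := by
  rcases v with _ | ⟨_ | _ | _, a, b, c, d⟩ <;> simp only [IsOver, IsUnder] at h ⊢ <;> omega

theorem IsUnder.isOver_finRotate {v : DiagramNode} {p : Fin v.arity} :
    v.IsUnder p → v.IsOver (finRotate _ p) := by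
  rcases v with _ | ⟨_ | _ | _, a, b, c, d⟩
  · exact id
  · exact (by decide : ∀ p : Fin 4, p.val % 2 = 1 → (finRotate 4 p).val % 2 = 0) p
  · exact (by decide : ∀ p : Fin 4, p.val % 2 = 0 → (finRotate 4 p).val % 2 = 1) p
  · exact id

theorem label_oppSlot_point (a b : ℕ) (p : Fin 2) :
    (point a b).label ((point a b).oppSlot p) = (![a, b] : Fin 2 → ℕ) (p + 1) :=
  congrArg (point a b).label (oppSlot_point a b p)

theorem label_oppSlot_crossing (k : CrossingKind) (a b c d : ℕ) (p : Fin 4) :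
    (crossing k a b c d).label ((crossing k a b c d).oppSlot p) =
      (![a, b, c, d] : Fin 4 → ℕ) (p + 2) :=
  congrArg (crossing k a b c d).label (oppSlot_crossing k a b c d p)

/-- Straight passages at a node, except under the other strand. -/
theorem links_iff {v : DiagramNode} {x y : ℕ} : v.Links x y ↔
    ∃ p, ¬ v.IsUnder p ∧ v.label p = x ∧ v.label (v.oppSlot p) = y := by
  rcases v with ⟨a, b⟩ | ⟨_ | _ | _, a, b, c, d⟩
  · change _ ↔ ∃ p : Fin 2, ¬ False ∧ (![a, b] : Fin 2 → ℕ) p = x ∧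
      (point a b).label ((point a b).oppSlot p) = y
    simp only [label_oppSlot_point]
    simp [Links, Fin.exists_fin_two, eq_comm]
  · change _ ↔ ∃ p : Fin 4, ¬ p.val % 2 = 1 ∧ (![a, b, c, d] : Fin 4 → ℕ) p = x ∧
      (crossing .firstOver a b c d).label ((crossing .firstOver a b c d).oppSlot p) = y
    simp only [label_oppSlot_crossing]
    simp [Links, Fin.exists_fin_succ, eq_comm]
  · change _ ↔ ∃ p : Fin 4, ¬ p.val % 2 = 0 ∧ (![a, b, c, d] : Fin 4 → ℕ) p = x ∧
      (crossing .secondOver a b c d).label ((crossing .secondOver a b c d).oppSlot p) = y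
    simp only [label_oppSlot_crossing]
    simp [Links, Fin.exists_fin_succ, eq_comm]
  · change _ ↔ ∃ p : Fin 4, ¬ False ∧ (![a, b, c, d] : Fin 4 → ℕ) p = x ∧
      (crossing .virt a b c d).label ((crossing .virt a b c d).oppSlot p) = y
    simp only [label_oppSlot_crossing]
    simp [Links, Fin.exists_fin_succ, eq_comm]
    tauto

theorem hasOver_iff {v : DiagramNode} {x : ℕ} :
    v.HasOver x ↔ ∃ p, v.IsOver p ∧ v.label p = x := by
  rcases v with ⟨a, b⟩ | ⟨_ | _ | _, a, b, c, d⟩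
  · simp [HasOver, IsOver]
  · change _ ↔ ∃ p : Fin 4, p.val % 2 = 0 ∧ (![a, b, c, d] : Fin 4 → ℕ) p = x
    simp [HasOver, Fin.exists_fin_succ, eq_comm]
  · change _ ↔ ∃ p : Fin 4, p.val % 2 = 1 ∧ (![a, b, c, d] : Fin 4 → ℕ) p = x
    simp [HasOver, Fin.exists_fin_succ, eq_comm]
  · simp [HasOver, IsOver]

theorem hasUnder_label {v : DiagramNode} {p : Fin v.arity} :
    v.IsUnder p → v.HasUnder (v.label p) (v.label (v.oppSlot p)) := by
  rcases v with ⟨a, b⟩ | ⟨_ | _ | _, a, b, c, d⟩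
  · exact id
  · suffices ∀ p : Fin 4, p.val % 2 = 1 → (crossing .firstOver a b c d).HasUnder
        ((![a, b, c, d] : Fin 4 → ℕ) p)
        ((crossing .firstOver a b c d).label ((crossing .firstOver a b c d).oppSlot p)) from this p
    simp only [label_oppSlot_crossing]
    simp [Fin.forall_fin_succ, HasUnder]
  · suffices ∀ p : Fin 4, p.val % 2 = 0 → (crossing .secondOver a b c d).HasUnder
        ((![a, b, c, d] : Fin 4 → ℕ) p)
        ((crossing .secondOver a b c d).label ((crossing .secondOver a b c d).oppSlot p)) from this p
    simp only [label_oppSlot_crossing]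
    simp [Fin.forall_fin_succ, HasUnder]
  · exact id

end DiagramNode

namespace Dart

variable {l : List DiagramNode}

theorem opp_opp (d : Dart l) : d.opp.opp = d :=
  Sigma.ext rfl (heq_of_eq ((l.get d.1).oppSlot_oppSlot d.2))

theorem isUnder_opp {d : Dart l} : d.opp.IsUnder ↔ d.IsUnder := (l.get d.1).isUnder_oppSlot d.2

theorem IsOver.not_isUnder {d : Dart l} (h : d.IsOver) : ¬ d.IsUnder :=
  DiagramNode.IsOver.not_isUnder h

theorem IsUnder.isOver_next {d : Dart l} (h : d.IsUnder) : d.next.IsOver :=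
  DiagramNode.IsUnder.isOver_finRotate h

end Dart

/-! ### Colorings and bridge decompositions -/

namespace VirtualKnotDiagram

variable {D : VirtualKnotDiagram}

open Dart

theorem strand_eq_of_label_eq {d e : Dart D.nodes} (h : d.label = e.label) :
    D.strand d = D.strand e := by
  by_cases hde : d = e
  · rw [hde]
  · exact Quot.sound (.inl ⟨hde, h⟩)

theorem strand_opp {d : Dart D.nodes} (h : ¬ d.IsUnder) : D.strand d.opp = D.strand d :=
  (Quot.sound (.inr ⟨h, rfl⟩)).symm

theorem exists_dart_of_links {v : DiagramNode} (hv : v ∈ D.nodes) {x y : ℕ} (h : v.Links x y) :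
    ∃ d : Dart D.nodes, ¬ d.IsUnder ∧ d.label = x ∧ d.opp.label = y := by
  obtain ⟨i, rfl⟩ := List.mem_iff_get.1 hv
  obtain ⟨p, hp⟩ := DiagramNode.links_iff.1 h
  exact ⟨⟨i, p⟩, hp⟩

theorem exists_dart_of_hasOver {v : DiagramNode} (hv : v ∈ D.nodes) {x : ℕ} (h : v.HasOver x) :
    ∃ d : Dart D.nodes, d.IsOver ∧ d.label = x := by
  obtain ⟨i, rfl⟩ := List.mem_iff_get.1 hv
  obtain ⟨p, hp⟩ := DiagramNode.hasOver_iff.1 h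
  exact ⟨⟨i, p⟩, hp⟩

theorem hasOver_label {d : Dart D.nodes} (h : d.IsOver) : (D.nodes.get d.1).HasOver d.label :=
  DiagramNode.hasOver_iff.2 ⟨d.2, h, rfl⟩

theorem strandOf_label_eq_iff {d e : Dart D.nodes} :
    strandOf D.nodes d.label = strandOf D.nodes e.label ↔ D.strand d = D.strand e := by
  constructor
  · intro h
    -- Values are sets of strands because `strandOf` also covers numbers that label no edge; for an
    -- edge label the value is a singleton.
    let g : ℕ → Set D.Strand := fun x => {s | ∃ d : Dart D.nodes, d.label = x ∧ D.strand d = s}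
    have hg : ∀ d : Dart D.nodes, g d.label = {D.strand d} := by
      intro d
      ext s
      constructor
      · rintro ⟨e, he, rfl⟩
        exact strand_eq_of_label_eq he
      · rintro rfl
        exact ⟨d, rfl, rfl⟩
    have key : g d.label = g e.label := congrArg (Quot.lift g (by
      rintro x y ⟨v, hv, hxy⟩
      obtain ⟨d, hd, rfl, rfl⟩ := exists_dart_of_links hv hxy
      rw [hg, hg, strand_opp hd])) h
    rw [hg, hg] at key
    exact Set.singleton_injective key
  · intro h
    refine congrArg (Quot.lift (fun d : Dart D.nodes => strandOf D.nodes d.label) ?_) h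
    rintro d e (h | ⟨h, rfl⟩)
    · exact congrArg _ h.2
    · exact strandOf_eq (List.get_mem D.nodes d.1) (DiagramNode.links_iff.2 ⟨d.2, h, rfl, rfl⟩)

instance : Finite D.Strand := Finite.of_surjective D.strand Quot.mk_surjective

theorem nonempty_dart (D : VirtualKnotDiagram) : Nonempty (Dart D.nodes) := by
  by_contra h
  rw [not_nonempty_iff] at h
  have h1 := D.one_component
  rw [Nat.card_eq_zero.2] at h1
  · exact absurd h1 (by simp)
  · exact .inl ⟨fun x => by obtain ⟨d, -⟩ := Quot.mk_surjective x; exact h.elim d⟩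

theorem along_connected {P : Dart D.nodes → Prop} (hP : ∀ d e, Along d e → (P d ↔ P e))
    {d : Dart D.nodes} (hd : P d) (e : Dart D.nodes) : P e := by
  have hsub : Subsingleton (Quot (Along (l := D.nodes))) :=
    (Nat.card_eq_one_iff_unique.1 D.one_component).1
  have key : P d = P e := congrArg (Quot.lift P fun d e h => propext (hP d e h))
    (Subsingleton.elim (Quot.mk _ d) (Quot.mk _ e))
  exact key ▸ hd

/-- The strands that become blue in the first `n` rounds of coloring moves. -/
def blueAfter (D : VirtualKnotDiagram) (seeds : Set D.Strand) : ℕ → Set D.Strand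
  | 0 => seeds
  | n + 1 => D.blueAfter seeds n ∪ {s | ∃ o u : Dart D.nodes, o.1 = u.1 ∧ o.IsOver ∧ u.IsUnder ∧
      D.strand o ∈ D.blueAfter seeds n ∧ D.strand u ∈ D.blueAfter seeds n ∧ s = D.strand u.opp}

theorem monotone_blueAfter (seeds : Set D.Strand) : Monotone (D.blueAfter seeds) :=
  monotone_nat_of_le_succ fun _ => Set.subset_union_left

theorem Blue.exists_mem_blueAfter {seeds : Set D.Strand} {s : D.Strand} (h : D.Blue seeds s) :
    ∃ n, s ∈ D.blueAfter seeds n := by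
  induction h with
  | seed h => exact ⟨0, h⟩
  | @move o u hnode ho hu _ _ ih₁ ih₂ =>
    obtain ⟨m, hm⟩ := ih₁
    obtain ⟨n, hn⟩ := ih₂
    exact ⟨max m n + 1, .inr ⟨o, u, hnode, ho, hu,
      monotone_blueAfter seeds (le_max_left m n) hm,
      monotone_blueAfter seeds (le_max_right m n) hn, rfl⟩⟩

/-- The level is the first round in which a strand is blue. A strand that becomes blue in round `n +
1` does so at a crossing whose other two strands were blue by round `n`, and level `0` means being a
seed. -/
theorem IsColorable.exists_ranked {k : ℕ} (h : D.IsColorable k) :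
    ∃ r H, Ranked D.nodes r H k := by
  classical
  obtain ⟨seeds, hfin, hcard, hblue⟩ := h
  have hex := fun s => (hblue s).exists_mem_blueAfter
  let level : D.Strand → ℕ := fun s => Nat.find (hex s)
  have hlevel : ∀ s, s ∈ D.blueAfter seeds (level s) := fun s => Nat.find_spec (hex s)
  have hle : ∀ {s n}, s ∈ D.blueAfter seeds n → level s ≤ n := fun {s n} h => Nat.find_min' (hex s) h
  let r : ℕ → ℕ := fun x =>
    if hx : ∃ d : Dart D.nodes, d.label = x then level (D.strand hx.choose) else 0
  have hr : ∀ d : Dart D.nodes, r d.label = level (D.strand d) := by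
    intro d
    have hx : ∃ e : Dart D.nodes, e.label = d.label := ⟨d, rfl⟩
    simp only [r, dif_pos hx]
    rw [strand_eq_of_label_eq hx.choose_spec]
  -- Any bound for all levels will do, for instance their sum.
  refine ⟨r, ((edgeLabels D.nodes).map r).sum, ?_, ?_, ?_, ?_⟩
  · intro v hv x y hxy
    obtain ⟨d, hd, rfl, rfl⟩ := exists_dart_of_links hv hxy
    rw [hr, hr, strand_opp hd]
  · intro v hv x hx
    exact List.le_sum_of_mem (List.mem_map_of_mem (mem_edgeLabels.2 ⟨v, hv, hx.mem_labels⟩))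
  · intro x hx h0 _
    obtain ⟨d, rfl⟩ := Dart.mem_edgeLabels.1 hx
    rw [hr] at h0
    obtain ⟨n, hn⟩ := Nat.exists_eq_succ_of_ne_zero h0.ne'
    have hd := hlevel (D.strand d)
    rw [hn] at hd
    rcases hd with hd | ⟨o, u, hou, ho, hu, hob, hub, hd⟩
    · have := hle hd; omega
    -- The move colors `u.opp`, so this is the beginning of the strand, and `u` is the understrand
    -- that was blue before.
    · refine ⟨D.nodes.get u.1, List.get_mem _ _, o.label, u.opp.label, u.label, ?_, ?_, ?_, ?_, ?_⟩
      · rw [← hou]; exact hasOver_label ho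
      · have := DiagramNode.hasUnder_label (isUnder_opp.2 hu)
        rwa [show (D.nodes.get u.opp.1).label ((D.nodes.get u.opp.1).oppSlot u.opp.2) = u.label from
          congrArg Dart.label (opp_opp u)] at this
      · rw [hr, hr, ← hd, hn]; exact Nat.lt_succ_of_le (hle hob)
      · rw [hr, hr, ← hd, hn]; exact Nat.lt_succ_of_le (hle hub)
      · exact strandOf_label_eq_iff.2 hd
  · refine ⟨hfin.toFinset.image fun s => (Quot.out s).label, ?_, ?_⟩
    · refine Finset.card_image_le.trans ?_
      rw [← hcard, Set.ncard_eq_toFinset_card _ hfin]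
    · intro x hx h0
      obtain ⟨d, rfl⟩ := Dart.mem_edgeLabels.1 hx
      rw [hr] at h0
      have hd := hlevel (D.strand d)
      rw [h0] at hd
      refine ⟨_, Finset.mem_image_of_mem _ (hfin.mem_toFinset.2 hd), ?_⟩
      exact strandOf_label_eq_iff.2 (Quot.out_eq _).symm

/-- If all overcrossings lie on few strands, then there is a bridge decomposition with few
overpasses. -/
theorem exists_isBridgeDecomposition (S : Finset ℕ) (hclass : ∃ d : Dart D.nodes, d.IsOver)
    (hS : ∀ d : Dart D.nodes, d.IsOver → ∃ s ∈ S, strandOf D.nodes d.label = strandOf D.nodes s) :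
    ∃ C, D.IsBridgeDecomposition C ∧ D.overpassCount C ≤ S.card := by
  let HasO : D.Strand → Prop := fun s => ∃ f : Dart D.nodes, f.IsOver ∧ D.strand f = s
  -- The cuts are the edges at the ends of strands with overcrossings. Strands without overcrossings
  -- are left to the underpasses.
  let C : Set ℕ := {x | ∃ d : Dart D.nodes, d.label = x ∧ d.IsUnder ∧ HasO (D.strand d)}
  let Good : Dart D.nodes → Prop := fun d => ¬ d.IsUnder ∧ HasO (D.strand d)
  have mate : ∀ {d e e' : Dart D.nodes}, SameEdge d e → SameEdge d e' → e = e' := fun {d e e'} h h' =>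
    (D.edge_ends d).unique h h'
  have hsymm : ∀ {d e : Dart D.nodes}, SameEdge d e → SameEdge e d := fun h => ⟨h.1.symm, h.2.symm⟩
  -- an edge with a label outside `C` is not under at any end if it is on a strand with overcrossings
  have notC : ∀ {d : Dart D.nodes}, HasO (D.strand d) → d.label ∉ C → ¬ d.IsUnder :=
    fun {d} ho hC hu => hC ⟨d, rfl, hu, ho⟩
  have inC : ∀ {d e : Dart D.nodes}, SameEdge d e → d.label ∈ C → d.IsUnder ∨ e.IsUnder := by
    rintro d e hde ⟨f, hf, hu, -⟩
    by_cases hfd : f = d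
    · exact .inl (hfd ▸ hu)
    · rw [mate hde ⟨Ne.symm hfd, hf.symm⟩]; exact .inr hu
  have inC' : ∀ {d : Dart D.nodes}, d.label ∈ C → HasO (D.strand d) := by
    rintro d ⟨f, hf, -, ho⟩
    rwa [strand_eq_of_label_eq hf] at ho
  have good_step : ∀ {d e : Dart D.nodes}, CutStep C d e → (Good d ↔ Good e) := by
    rintro d e (⟨hde, hC⟩ | rfl)
    · have hs := strand_eq_of_label_eq hde.2
      have hC' : e.label ∉ C := hde.2 ▸ hC
      exact ⟨fun h => ⟨notC (hs ▸ h.2) hC', hs ▸ h.2⟩, fun h => ⟨notC (hs ▸ h.2) hC, hs ▸ h.2⟩⟩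
    · by_cases hu : d.IsUnder
      · exact ⟨fun h => absurd hu h.1, fun h => absurd (isUnder_opp.2 hu) h.1⟩
      · simp only [Good, strand_opp hu, isUnder_opp]
  have good_path : ∀ {d e : Dart D.nodes}, D.path C d = D.path C e → (Good d ↔ Good e) :=
    fun {d e} h => Iff.of_eq (congrArg (Quot.lift Good fun d e h => propext (good_step h)) h)
  have good_over : ∀ {d : Dart D.nodes}, d.IsOver → Good d := fun {d} h =>
    ⟨h.not_isUnder, d, h, rfl⟩
  -- good darts of one strand are on one path
  have good_strand : ∀ {d e : Dart D.nodes}, Good d → Good e → D.strand d = D.strand e →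
      D.path C d = D.path C e := by
    intro d e hd he hde
    -- The strand of `d` consists of darts on its path together with under-ends just across the
    -- cuts. `T` says this and is invariant along strands.
    let T : Dart D.nodes → Prop := fun f => (¬ f.IsUnder ∧ D.path C f = D.path C d) ∨
      (f.IsUnder ∧ ∃ g, SameEdge f g ∧ ¬ g.IsUnder ∧ D.path C g = D.path C d)
    have edge : ∀ {f g : Dart D.nodes}, SameEdge f g → T f → T g := by
      rintro f g hfg (⟨h1, h2⟩ | ⟨h1, g', hg', h3, h4⟩)
      · by_cases hg : g.IsUnder
        · exact .inr ⟨hg, f, hsymm hfg, h1, h2⟩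
        · refine .inl ⟨hg, ?_⟩
          have hC : f.label ∉ C := fun hC => (inC hfg hC).elim h1 hg
          rw [← h2]
          exact (Quot.sound (.inl ⟨hfg, hC⟩)).symm
      · rw [mate hfg hg']; exact .inl ⟨h3, h4⟩
    have step : ∀ f g, StrandStep f g → T f = T g := by
      rintro f g (hfg | ⟨hf, rfl⟩)
      · exact propext ⟨edge hfg, edge (hsymm hfg)⟩
      · have hp : D.path C f = D.path C f.opp := Quot.sound (.inr rfl)
        simp only [T, isUnder_opp, hf, ← hp, false_and, or_false]
    have key : T d = T e := congrArg (Quot.lift T step) hde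
    have hTe : T e := key ▸ .inl ⟨hd.1, rfl⟩
    rcases hTe with h | h
    · exact h.2.symm
    · exact absurd h.1 he.1
  have overpass_of_good : ∀ {d : Dart D.nodes}, Good d → D.IsOverpass (D.path C d) := by
    intro d hd
    obtain ⟨f, hf, hfd⟩ := hd.2
    exact ⟨⟨f, good_strand (good_over hf) hd hfd, hf⟩, fun e he => ((good_path he).2 hd).1⟩
  have underpass_of_bad : ∀ {d : Dart D.nodes}, ¬ Good d → D.IsUnderpass (D.path C d) := by
    intro d hd
    refine ⟨?_, fun e he ho => hd ((good_path he).1 (good_over ho))⟩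
    by_contra hno
    have hno : ∀ e, D.path C e = D.path C d → ¬ e.IsUnder := fun e he hu => hno ⟨e, he, hu⟩
    -- Without undercrossings a bad path never meets a cut, since a dart at a cut that is not under
    -- is good. The path would be the whole knot and contain the overcrossing of `hclass`.
    have hstep : ∀ e f, Along e f → D.path C e = D.path C d → D.path C f = D.path C d := by
      rintro e f (hef | rfl) he
      · have hC : e.label ∉ C := by
          intro hC
          exact hd ((good_path he).1 ⟨hno e he, inC' hC⟩)
        rw [← he]
        exact (Quot.sound (.inl ⟨hef, hC⟩)).symm
      · rw [← he]
        exact (Quot.sound (.inr rfl)).symm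
    have hsym : ∀ {e f : Dart D.nodes}, Along e f → Along f e := by
      rintro e f (hef | rfl)
      · exact .inl (hsymm hef)
      · exact .inr (opp_opp e).symm
    obtain ⟨f, hf⟩ := hclass
    have hall := along_connected (P := fun e => D.path C e = D.path C d)
      (fun e f h => ⟨hstep e f h, hstep f e (hsym h)⟩) rfl
    exact hd ((good_path (hall f)).1 (good_over hf))
  have good_iff_over : ∀ {d : Dart D.nodes}, D.IsOverpass (D.path C d) ↔ Good d := by
    intro d
    refine ⟨fun h => ?_, overpass_of_good⟩
    obtain ⟨⟨f, hf, ho⟩, -⟩ := h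
    exact (good_path hf).1 (good_over ho)
  have bad_iff_under : ∀ {d : Dart D.nodes}, D.IsUnderpass (D.path C d) ↔ ¬ Good d := by
    intro d
    refine ⟨fun h hg => ?_, underpass_of_bad⟩
    obtain ⟨⟨f, hf, hu⟩, -⟩ := h
    exact ((good_path hf).2 hg).1 hu
  refine ⟨C, ⟨?_, ?_⟩, ?_⟩
  · intro P
    obtain ⟨d, rfl⟩ := Quot.mk_surjective P
    by_cases hd : Good d
    · exact .inl (overpass_of_good hd)
    · exact .inr (underpass_of_bad hd)
  · intro d e hde hC
    rw [good_iff_over, bad_iff_under]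
    have hod := inC' hC
    have hoe : HasO (D.strand e) := strand_eq_of_label_eq hde.2 ▸ hod
    -- Were the edge under at both ends, it would be an entire strand, without overcrossings.
    have hnot : ¬ (d.IsUnder ∧ e.IsUnder) := by
      rintro ⟨hd, he⟩
      let T : Dart D.nodes → Prop := fun f => f = d ∨ f = e
      have hTu : ∀ {f}, T f → f.IsUnder := by rintro f (rfl | rfl) <;> assumption
      have edge : ∀ {f g : Dart D.nodes}, SameEdge f g → T f → T g := by
        rintro f g hfg (rfl | rfl)
        · exact .inr (mate hfg hde)
        · exact .inl (mate hfg (hsymm hde))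
      have step : ∀ f g, StrandStep f g → T f = T g := by
        rintro f g (hfg | ⟨hf, rfl⟩)
        · exact propext ⟨edge hfg, edge (hsymm hfg)⟩
        · exact propext ⟨fun h => absurd (hTu h) hf, fun h => absurd (isUnder_opp.1 (hTu h)) hf⟩
      obtain ⟨f, hf, hfd⟩ := hod
      have key : T f = T d := congrArg (Quot.lift T step) hfd
      exact hf.not_isUnder (hTu (key ▸ .inl rfl))
    have hor := inC hde hC
    simp only [Good, hod, hoe, and_true]
    tauto
  · choose s hsS hs using hS
    have hover : ∀ P : {P : D.Path C // D.IsOverpass P}, ∃ d, D.path C d = P.1 ∧ d.IsOver :=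
      fun P => P.2.1
    choose f hf hfo using hover
    -- An overpass goes to a member of `S` on its strand; by `good_strand` a strand carries only one
    -- overpass.
    let g : {P : D.Path C // D.IsOverpass P} → S := fun P => ⟨s (f P) (hfo P), hsS _ _⟩
    have hg : Function.Injective g := by
      intro P Q hPQ
      have h1 : s (f P) (hfo P) = s (f Q) (hfo Q) := congrArg Subtype.val hPQ
      have h2 := (hs _ (hfo P)).trans ((congrArg _ h1).trans (hs _ (hfo Q)).symm)
      have h3 := good_strand (good_over (hfo P)) (good_over (hfo Q)) (strandOf_label_eq_iff.1 h2)
      exact Subtype.ext ((hf P).symm.trans (h3.trans (hf Q)))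
    have := Nat.card_le_card_of_injective g hg
    simpa [overpassCount] using this

/-- The strands of the overpasses of a bridge decomposition are seeds. -/
theorem IsBridgeDecomposition.exists_isColorable {C : Set ℕ} (hC : D.IsBridgeDecomposition C) :
    ∃ k ≤ D.overpassCount C, D.IsColorable k := by
  have : Finite (D.Path C) := Finite.of_surjective (D.path C) Quot.mk_surjective
  have over_pass : ∀ {d : Dart D.nodes}, d.IsOver → D.IsOverpass (D.path C d) := by
    intro d hd
    exact (hC.1 _).resolve_right fun h => h.2 d rfl hd
  let seeds : Set D.Strand := {s | ∃ d, D.strand d = s ∧ D.IsOverpass (D.path C d)}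
  have hconst : ∀ {d e : Dart D.nodes}, D.IsOverpass (D.path C d) → D.path C d = D.path C e →
      D.strand d = D.strand e := by
    intro d e hd hde
    -- An overpass never passes under, so moving along it does not leave the strand.
    let T : Dart D.nodes → Prop := fun f => D.path C f = D.path C d ∧ D.strand f = D.strand d
    have step : ∀ f g, CutStep C f g → T f = T g := by
      intro f g hfg
      have hp : D.path C f = D.path C g := Quot.sound hfg
      have hs : D.path C f = D.path C d → D.strand f = D.strand g := by
        intro hf
        rcases hfg with hfg | rfl
        · exact strand_eq_of_label_eq hfg.1.2
        · exact (strand_opp (hd.2 f hf)).symm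
      refine propext ⟨fun h => ⟨hp ▸ h.1, hs h.1 ▸ h.2⟩, fun h => ?_⟩
      have h1 : D.path C f = D.path C d := hp.trans h.1
      exact ⟨h1, (hs h1).trans h.2⟩
    have key : T d = T e := congrArg (Quot.lift T step) hde
    have hTe : T e := key ▸ ⟨rfl, rfl⟩
    exact hTe.2.symm
  have hfin : seeds.Finite := Set.toFinite _
  refine ⟨seeds.ncard, ?_, seeds, hfin, rfl, ?_⟩
  · choose f hf hfo using fun s : seeds => s.2
    have hinj : Function.Injective
        (fun s => ⟨D.path C (f s), hfo s⟩ : seeds → {P : D.Path C // D.IsOverpass P}) := by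
      intro s s' h
      have h1 := hconst (hfo s) (congrArg Subtype.val h)
      rw [hf, hf] at h1
      exact Subtype.ext h1
    exact Nat.card_le_card_of_injective _ hinj
  · have hblue : ∀ {d : Dart D.nodes}, d.IsOver → D.Blue seeds (D.strand d) :=
      fun {d} hd => .seed ⟨d, rfl, over_pass hd⟩
    -- Every overstrand is a seed, so each undercrossing passes the color on.
    have hopp : ∀ d : Dart D.nodes, D.Blue seeds (D.strand d) → D.Blue seeds (D.strand d.opp) := by
      intro d hd
      by_cases hu : d.IsUnder
      · exact .move (o := d.next) rfl hu.isOver_next hu (hblue hu.isOver_next) hd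
      · rwa [strand_opp hu]
    obtain ⟨d₀⟩ := D.nonempty_dart
    obtain ⟨d, hd⟩ : ∃ d : Dart D.nodes, d.IsOver := by
      rcases hC.1 (D.path C d₀) with h | h
      · obtain ⟨⟨d, -, hd⟩, -⟩ := h; exact ⟨d, hd⟩
      · obtain ⟨⟨d, -, hd⟩, -⟩ := h; exact ⟨d.next, hd.isOver_next⟩
    have hall := along_connected (P := fun e => D.Blue seeds (D.strand e)) (by
      rintro e f (hef | rfl)
      · rw [strand_eq_of_label_eq hef.2]
      · exact ⟨hopp e, fun h => opp_opp e ▸ hopp _ h⟩) (hblue hd)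
    intro s
    obtain ⟨e, rfl⟩ := Quot.mk_surjective s
    exact hall e

theorem isColorable_wirtingerNumber (D : VirtualKnotDiagram) :
    D.IsColorable D.wirtingerNumber :=
  Nat.sInf_mem (s := {k | D.IsColorable k})
    ⟨_, Set.univ, Set.finite_univ, rfl, fun _ => .seed trivial⟩

/-- There is at least one strand, and nothing becomes blue without seeds. This covers the case where
the bridge decomposition comes from a kink. -/
theorem IsColorable.pos {k : ℕ} (h : D.IsColorable k) : 0 < k := by
  obtain ⟨seeds, hfin, rfl, hblue⟩ := h
  rw [Nat.pos_iff_ne_zero, Ne, Set.ncard_eq_zero hfin]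
  rintro rfl
  obtain ⟨d⟩ := D.nonempty_dart
  have : ∀ s, ¬ D.Blue ∅ s := by
    intro s hs
    induction hs with
    | seed h => exact h
    | move _ _ _ _ _ ih _ => exact ih
  exact this _ (hblue (D.strand d))

end VirtualKnotDiagram

/-! ### Comparison of the two invariants -/

namespace WeldedKnot

variable {K : WeldedKnot}

/-- If all overcrossings of a diagram of `K` lie on few strands, then `K` has a bridge decomposition
with few overpasses. -/
theorem Presents.exists_overpassCount_le {l : List DiagramNode} (hK : K.Presents l) (S : Finset ℕ)
    (hclass : ∃ v ∈ l, ∃ x, v.HasOver x)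
    (hS : ∀ v ∈ l, ∀ x, v.HasOver x → ∃ s ∈ S, strandOf l x = strandOf l s) :
    ∃ (D : VirtualKnotDiagram) (C : Set ℕ), D.toWeldedKnot = K ∧ D.IsBridgeDecomposition C ∧
      D.overpassCount C ≤ S.card := by
  obtain ⟨D, rfl, rfl⟩ := hK
  obtain ⟨v, hv, x, hx⟩ := hclass
  obtain ⟨d, hd, -⟩ := VirtualKnotDiagram.exists_dart_of_hasOver hv hx
  obtain ⟨C, hC, hle⟩ := VirtualKnotDiagram.exists_isBridgeDecomposition S ⟨d, hd⟩
    fun d hd => hS _ (List.get_mem _ _) _ (VirtualKnotDiagram.hasOver_label hd)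
  exact ⟨D, C, rfl, hC, hle⟩

theorem exists_not_mem (l : List ℕ) : ∃ x, x ∉ l := by
  obtain ⟨x, hx⟩ := Infinite.exists_notMem_finset l.toFinset
  exact ⟨x, by simpa using hx⟩

/-- A diagram without classical crossings has a bridge decomposition with one overpass, after a
kink has been added. -/
theorem Presents.exists_overpassCount_le_one {l : List DiagramNode} (hK : K.Presents l)
    (hvirt : ∀ v ∈ l, ∀ x, ¬ v.HasOver x) :
    ∃ (D : VirtualKnotDiagram) (C : Set ℕ), D.toWeldedKnot = K ∧ D.IsBridgeDecomposition C ∧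
      D.overpassCount C ≤ 1 := by
  -- The first Reidemeister move starts from a point, so one is created if the list begins with a
  -- crossing; the empty list has no component.
  obtain ⟨b, c, t, hK', hvirt'⟩ : ∃ (b c : ℕ) (t : List DiagramNode),
      K.Presents (.point b c :: t) ∧ ∀ v ∈ t, ∀ x, ¬ v.HasOver x := by
    rcases l with _ | ⟨⟨b, c⟩ | ⟨k, a, x, y, z⟩, t⟩
    · obtain ⟨D, hD, -⟩ := hK
      obtain ⟨d⟩ := D.nonempty_dart
      exact absurd d.1.2 (by simp [hD])
    · exact ⟨b, c, t, hK, fun v hv => hvirt v (List.mem_cons_of_mem _ hv)⟩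
    · obtain ⟨b, hb⟩ := exists_not_mem ([a, x, y, z] ++ edgeLabels t)
      rw [List.mem_append, not_or] at hb
      refine ⟨a, b, _, (Presents.subdivide_iff hb.1 hb.2).1 hK, fun v hv x hx => ?_⟩
      rcases List.mem_cons.1 hv with rfl | hv
      · have := hvirt _ List.mem_cons_self
        cases k with
        | firstOver => exact this _ (.inl rfl)
        | secondOver => exact this _ (.inl rfl)
        | virt => exact hx
      · exact hvirt v (List.mem_cons_of_mem _ hv) x hx
  obtain ⟨a, ha⟩ := exists_not_mem ([b, c] ++ edgeLabels t)
  rw [List.mem_append, not_or] at ha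
  have hK₂ := hK'.kink (k := .firstOver) ha.1 ha.2
  refine hK₂.exists_overpassCount_le {a} ⟨_, List.mem_cons_self, a, .inl rfl⟩ ?_
  intro v hv x hx
  refine ⟨a, Finset.mem_singleton_self a, ?_⟩
  rcases List.mem_cons.1 hv with rfl | hv
  · rcases hx with rfl | rfl
    · rfl
    · exact strandOf_eq List.mem_cons_self (.inr ⟨rfl, rfl⟩)
  · exact absurd hx (hvirt' v hv x)

theorem exists_overpassCount_le_wirtingerNumber (D : VirtualKnotDiagram) :
    ∃ (D' : VirtualKnotDiagram) (C : Set ℕ), D'.toWeldedKnot = D.toWeldedKnot ∧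
      D'.IsBridgeDecomposition C ∧ D'.overpassCount C ≤ D.wirtingerNumber := by
  obtain ⟨r, H, hr⟩ := D.isColorable_wirtingerNumber.exists_ranked
  have hK : D.toWeldedKnot.PresentsRanked D.nodes r H D.wirtingerNumber _ := ⟨⟨D, rfl, rfl⟩, hr, rfl⟩
  obtain ⟨l, h, hl, hrl⟩ := hK.exists_level_zero
  by_cases hclass : ∃ v ∈ l, ∃ x, v.HasOver x
  · obtain ⟨S, hS, hS'⟩ := hrl.seeds
    obtain ⟨D', C, h1, h2, h3⟩ := hl.exists_overpassCount_le S hclass fun v hv x hx =>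
      hS' x (mem_edgeLabels.2 ⟨v, hv, hx.mem_labels⟩) (Nat.le_zero.1 (hrl.over_le v hv x hx))
    exact ⟨D', C, h1, h2, h3.trans hS⟩
  · push Not at hclass
    obtain ⟨D', C, h1, h2, h3⟩ := hl.exists_overpassCount_le_one hclass
    exact ⟨D', C, h1, h2, h3.trans D.isColorable_wirtingerNumber.pos⟩

end WeldedKnot

theorem mainTheorem9 (K : WeldedKnot) :
    K.wirtingerNumber = K.overpassBridgeNumber := by
  have hbridge : ∀ D : VirtualKnotDiagram, D.toWeldedKnot = K →
      K.overpassBridgeNumber ≤ D.wirtingerNumber := by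
    rintro D rfl
    obtain ⟨D', C, h1, h2, h3⟩ := WeldedKnot.exists_overpassCount_le_wirtingerNumber D
    have hmem : D'.overpassCount C ∈ {n | ∃ (E : VirtualKnotDiagram) (C : Set ℕ),
        E.toWeldedKnot = D.toWeldedKnot ∧ E.IsBridgeDecomposition C ∧ E.overpassCount C = n} :=
      ⟨D', C, h1, h2, rfl⟩
    exact (Nat.sInf_le hmem).trans h3
  obtain ⟨D₀, hD₀⟩ : ∃ D : VirtualKnotDiagram, D.toWeldedKnot = K := Quot.mk_surjective K
  refine le_antisymm ?_ ?_
  -- Some bridge decomposition exists, so the infimum is attained and is not the default value `0`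
  -- of the empty set.
  · obtain ⟨D', C', h1', h2', -⟩ := WeldedKnot.exists_overpassCount_le_wirtingerNumber D₀
    obtain ⟨D, C, hD, hC, hn⟩ := Nat.sInf_mem (s := {n | ∃ (D : VirtualKnotDiagram) (C : Set ℕ),
      D.toWeldedKnot = K ∧ D.IsBridgeDecomposition C ∧ D.overpassCount C = n})
      ⟨_, D', C', h1'.trans hD₀, h2', rfl⟩
    obtain ⟨k, hk, hcol⟩ := hC.exists_isColorable
    calc K.wirtingerNumber ≤ D.wirtingerNumber := Nat.sInf_le ⟨D, hD, rfl⟩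
      _ ≤ k := Nat.sInf_le hcol
      _ ≤ D.overpassCount C := hk
      _ = K.overpassBridgeNumber := hn
  · obtain ⟨D, hD, hn⟩ := Nat.sInf_mem (s := {k | ∃ D : VirtualKnotDiagram,
      D.toWeldedKnot = K ∧ D.wirtingerNumber = k}) ⟨_, D₀, hD₀, rfl⟩
    calc K.overpassBridgeNumber ≤ D.wirtingerNumber := hbridge D hD
      _ = K.wirtingerNumber := hn
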